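/- Let $d\in\mathbb N$, $\mathbb T^d=[-\pi,\pi]^d$ with Lebesgue measure, and let $\Phi:\ell_2(\mathbb Z^d,\mathbb C^m)\to L_2(\mathbb T^d,\mathbb C^m)$ be the discrete Fourier transform $$(\Phi u)(x)=(2\pi)^{-d/2}\sum_{n\in\mathbb Z^d}e^{-i n\cdot x}u(n),$$ the series converging in $L_2$. For a measurable complex function $g$ on a measure space $(\mathcal Z,\mu)$ and $0<p<\infty$ put $\mu_g(s)=\mu\{z:|g(z)|>s\}$ and $\|g\|_{L_{p,\infty}}=\sup_{s>0}s\,\mu_g(s)^{1/p}$. Then $L_{p,\infty}$ is the class of $g$ for which this is finite, and $L^0_{p,\infty}$ is the subclass of those $g\in L_{p,\infty}$ with $\mu_g(s)=o(s^{-p})$ as $s\to+0$ and as $s\to+\infty$. For $\mathbb Z^d$ with the counting measure these classes are denoted $\ell_{p,\infty}(\mathbb Z^d)$ and $\ell^0_{p,\infty}(\mathbb Z^d)$. A matrix-valued function belongs to one of the classes $L_q$, $L_{p,\infty}$, $L^0_{p,\infty}$ if all its entries do, and its (quasi)norm is the maximum of the (quasi)norms of its entries. For a compact operator $A$ between Hilbert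 spaces let $s_m(A)$ be its singular numbers, that is, the eigenvalues of $|A|=(A^*A)^{1/2}$ repeated according to multiplicity, and let $n(s,A)=\#\{m:s_m(A)>s\}$. The class $\mathfrak S_{p,\infty}$ consists of the compact operators $A$ with $\|A\|_{\mathfrak S_{p,\infty}}=\sup_{s>0}s\,n(s,A)^{1/p}<\infty$, and $\mathfrak S^0_{p,\infty}$ of those $A\in\mathfrak S_{p,\infty}$ with $n(s,A)=o(s^{-p})$ as $s\to+0$. **Proposition.** Let $p\in(0,\infty)$, and let $q=p$ if $p>2$; $q=2$ if $p<2$; and let $2<q\le\infty$ be arbitrary if $p=2$. Let $m_1,m_2,m_3\in\mathbb N$. There is a constant $C$, depending only on $p,q,d,m_1,m_2,m_3$, such that for every $m_1\times m_2$-matrix-valued function $f\in L_q(\mathbb T^d)$ and every $m_2\times m_3$-matrix-valued function $\mathbb V\in\ell_{p,\infty}(\mathbb Z^d)$ the following holds. The operator $f\Phi\mathbb V$, $u\mapsto f(x)\,(\Phi(\mathbb Vu))(x)$ with $(\mathbb Vu)(n)=\mathbb V(n)u(n)$, is defined on the whole of $\ell_2(\mathbb Z^d,\mathbb C^{m_3})$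 and is bounded into $L_2(\mathbb T^d,\mathbb C^{m_1})$; it belongs to $\mathfrak S_{p,\infty}$, and $$\|f\Phi\mathbb V\|_{\mathfrak S_{p,\infty}}\le C\,\|f\|_{L_q}\,\|\mathbb V\|_{\ell_{p,\infty}}.$$ If in addition $\mathbb V\in\ell^0_{p,\infty}(\mathbb Z^d)$, then $f\Phi\mathbb V\in\mathfrak S^0_{p,\infty}$. -/

import Mathlib

open MeasureTheory Filter Topology
open scoped ENNReal NNReal InnerProductSpace Matrix

noncomputable section

namespace Cwikel

/-! ### Weak Lebesgue classes -/

section WeakLp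

variable {Z E : Type*} [MeasurableSpace Z] [NormedAddCommGroup E]

/-- The distribution function `μ_f(s) = μ {z : |f z| > s}`. -/
def distribution (f : Z → E) (μ : Measure Z) (s : ℝ) : ℝ≥0∞ :=
  μ {z | s < ‖f z‖}

/-- The quasinorm `sup_{s > 0} s * μ_f(s) ^ (1 / p)` of the weak class `L_{p,∞}`. -/
def weakNorm (f : Z → E) (p : ℝ) (μ : Measure Z) : ℝ≥0∞ :=
  ⨆ (s : ℝ) (_ : 0 < s), ENNReal.ofReal s * distribution f μ s ^ (1 / p)

/-- The weak class `L_{p,∞}(Z, μ)`. -/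
def MemWeak (f : Z → E) (p : ℝ) (μ : Measure Z) : Prop :=
  AEStronglyMeasurable f μ ∧ weakNorm f p μ < ∞

/-- The subclass `L⁰_{p,∞}(Z, μ)`: `μ_f(s) = o(s ^ (-p))` as `s → +0` and as `s → +∞`. -/
def MemWeakZero (f : Z → E) (p : ℝ) (μ : Measure Z) : Prop :=
  MemWeak f p μ ∧
    Tendsto (fun s : ℝ => ENNReal.ofReal (s ^ p) * distribution f μ s) (𝓝[>] 0) (𝓝 0) ∧
    Tendsto (fun s : ℝ => ENNReal.ofReal (s ^ p) * distribution f μ s) atTop (𝓝 0)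

end WeakLp

/-! ### Matrix-valued functions (all classes are understood entrywise) -/

section MatrixValued

variable {Z : Type*} [MeasurableSpace Z] {m n : ℕ}

/-- A matrix-valued function belongs to `L_q` if all its entries do. -/
def MatMemLp (f : Z → Matrix (Fin m) (Fin n) ℂ) (q : ℝ≥0∞) (μ : Measure Z) : Prop :=
  ∀ i j, MemLp (fun z => f z i j) q μ

/-- `max_{i,j} ‖f_{ij}‖_{L_q}`. -/
def matLpNorm (f : Z → Matrix (Fin m) (Fin n) ℂ) (q : ℝ≥0∞) (μ : Measure Z) : ℝ≥0∞ :=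
  ⨆ (i) (j), eLpNorm (fun z => f z i j) q μ

/-- A matrix-valued function belongs to `L_{p,∞}` if all its entries do. -/
def MatMemWeak (f : Z → Matrix (Fin m) (Fin n) ℂ) (p : ℝ) (μ : Measure Z) : Prop :=
  ∀ i j, MemWeak (fun z => f z i j) p μ

/-- A matrix-valued function belongs to `L⁰_{p,∞}` if all its entries do. -/
def MatMemWeakZero (f : Z → Matrix (Fin m) (Fin n) ℂ) (p : ℝ) (μ : Measure Z) : Prop :=
  ∀ i j, MemWeakZero (fun z => f z i j) p μ

/-- `max_{i,j} ‖f_{ij}‖_{L_{p,∞}}`. -/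
def matWeakNorm (f : Z → Matrix (Fin m) (Fin n) ℂ) (p : ℝ) (μ : Measure Z) : ℝ≥0∞ :=
  ⨆ (i) (j), weakNorm (fun z => f z i j) p μ

end MatrixValued

/-! ### Singular numbers and the weak Schatten classes -/

section Schatten

variable {H₁ H₂ : Type*} [NormedAddCommGroup H₁] [InnerProductSpace ℂ H₁] [CompleteSpace H₁]
  [NormedAddCommGroup H₂] [InnerProductSpace ℂ H₂] [CompleteSpace H₂]

/-- The modulus `|A| = (A* A) ^ (1 / 2)`. -/
def modulus (A : H₁ →L[ℂ] H₂) : H₁ →L[ℂ] H₁ :=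
  CFC.sqrt (ContinuousLinearMap.adjoint A ∘L A)

/-- The singular number distribution function `n(s, A) = #{m : s_m(A) > s}`, where the `s_m(A)`
are the eigenvalues of `|A|` repeated according to multiplicity. Since `|A|` is self-adjoint, its
eigenspaces are orthogonal, and the count with multiplicity of the eigenvalues greater than `s` is
the dimension of the span of the corresponding eigenspaces. -/
def singularCount (s : ℝ) (A : H₁ →L[ℂ] H₂) : ℕ∞ :=
  Cardinal.toENat (Module.rank ℂ
    (⨆ (t : ℝ) (_ : s < t),
      Module.End.eigenspace (modulus A : H₁ →ₗ[ℂ] H₁) (t : ℂ) : Submodule ℂ H₁))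

/-- The quasinorm `sup_{s > 0} s * n(s, A) ^ (1 / p)`. -/
def schattenWeakNorm (p : ℝ) (A : H₁ →L[ℂ] H₂) : ℝ≥0∞ :=
  ⨆ (s : ℝ) (_ : 0 < s), ENNReal.ofReal s * (singularCount s A : ℝ≥0∞) ^ (1 / p)

/-- The class `𝔖_{p,∞}` of compact operators. -/
def MemSchattenWeak (p : ℝ) (A : H₁ →L[ℂ] H₂) : Prop :=
  IsCompactOperator A ∧ schattenWeakNorm p A < ∞

/-- The subclass `𝔖⁰_{p,∞}`: `n(s, A) = o(s ^ (-p))` as `s → +0`. -/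
def MemSchattenWeakZero (p : ℝ) (A : H₁ →L[ℂ] H₂) : Prop :=
  MemSchattenWeak p A ∧
    Tendsto (fun s : ℝ => ENNReal.ofReal (s ^ p) * (singularCount s A : ℝ≥0∞)) (𝓝[>] 0) (𝓝 0)

end Schatten

/-! ### The discrete Fourier transform -/

/-- Lebesgue measure on the cube `𝕋^d = [-π, π]^d`. -/
def torusMeasure (d : ℕ) : Measure (Fin d → ℝ) :=
  volume.restrict (Set.Icc (fun _ => -Real.pi) (fun _ => Real.pi))

/-- `ℓ₂(ℤ^d, ℂ^m)`. -/
abbrev SeqSpace (d m : ℕ) : Type :=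
  lp (fun _ : Fin d → ℤ => EuclideanSpace ℂ (Fin m)) 2

/-- `L₂(𝕋^d, ℂ^m)`. -/
abbrev FunSpace (d m : ℕ) : Type :=
  Lp (EuclideanSpace ℂ (Fin m)) 2 (torusMeasure d)

/-- The character `(2π)^(-d/2) * exp(-i n·x)`. -/
def character {d : ℕ} (n : Fin d → ℤ) (x : Fin d → ℝ) : ℂ :=
  (((2 * Real.pi) ^ (-(d : ℝ) / 2) : ℝ) : ℂ) *
    Complex.exp (-Complex.I * ((∑ j, (n j : ℝ) * x j : ℝ) : ℂ))

instance (d : ℕ) : IsFiniteMeasure (torusMeasure d) := by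
  unfold torusMeasure
  exact ⟨by rw [Measure.restrict_apply_univ]; exact isCompact_Icc.measure_lt_top⟩

theorem continuous_character {d : ℕ} (n : Fin d → ℤ) : Continuous (character n) := by
  unfold character; fun_prop

theorem norm_character {d : ℕ} (n : Fin d → ℤ) (x : Fin d → ℝ) :
    ‖character n x‖ = (2 * Real.pi) ^ (-(d : ℝ) / 2) := by
  unfold character
  rw [norm_mul, Complex.norm_exp, Complex.norm_real, Real.norm_eq_abs,
    abs_of_nonneg (by positivity)]
  simp

theorem memLp_character_smul {d m : ℕ} (n : Fin d → ℤ) (v : EuclideanSpace ℂ (Fin m)) :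
    MemLp (fun x => character n x • v) 2 (torusMeasure d) := by
  refine MemLp.of_bound ((continuous_character n).smul continuous_const).aestronglyMeasurable
    ((2 * Real.pi) ^ (-(d : ℝ) / 2) * ‖v‖) (Eventually.of_forall fun x => ?_)
  rw [norm_smul, norm_character]

theorem torusMeasure_eq_pi (d : ℕ) : torusMeasure d =
    Measure.pi fun _ : Fin d => (volume : Measure ℝ).restrict (Set.Icc (-Real.pi) Real.pi) := by
  unfold torusMeasure
  rw [← Set.pi_univ_Icc, volume_pi, Measure.restrict_pi_pi]

theorem integral_exp_int (k : ℤ) :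
    ∫ x in Set.Icc (-Real.pi) Real.pi, Complex.exp (-Complex.I * ((k : ℝ) * x : ℝ)) =
      if k = 0 then ((2 * Real.pi : ℝ) : ℂ) else 0 := by
  rw [integral_Icc_eq_integral_Ioc, ← intervalIntegral.integral_of_le (by linarith [Real.pi_pos])]
  split_ifs with hk
  · subst hk
    simp
    ring
  · have hc : (-Complex.I * (k : ℂ)) ≠ 0 := by simp [hk]
    have h1 : ∀ x : ℝ, Complex.exp (-Complex.I * ((k : ℝ) * x : ℝ)) =
        Complex.exp ((-Complex.I * (k : ℂ)) * x) := by
      intro x; congr 1; push_cast; ring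
    simp_rw [h1]
    rw [integral_exp_mul_complex hc, div_eq_zero_iff, sub_eq_zero]
    left
    rw [Complex.exp_eq_exp_iff_exists_int]
    exact ⟨-k, by push_cast; ring⟩

theorem integral_conj_character_mul {d : ℕ} (n k : Fin d → ℤ) :
    ∫ x, (starRingEnd ℂ) (character n x) * character k x ∂(torusMeasure d) =
      if n = k then 1 else 0 := by
  have h1 : ∀ x : Fin d → ℝ, (starRingEnd ℂ) (character n x) * character k x =
      (((2 * Real.pi) ^ (-(d : ℝ)) : ℝ) : ℂ) *
        ∏ j, Complex.exp (-Complex.I * (((k j - n j : ℤ) : ℝ) * x j : ℝ)) := by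
    intro x
    unfold character
    rw [← Complex.exp_sum, map_mul, ← Complex.exp_conj, Complex.conj_ofReal,
      mul_mul_mul_comm, ← Complex.exp_add, ← Complex.ofReal_mul,
      ← Real.rpow_add (by positivity)]
    congr 2
    · ring_nf
    · simp only [map_mul, map_neg, Complex.conj_I, Complex.conj_ofReal]
      push_cast
      rw [← Finset.mul_sum]
      simp only [sub_mul, Finset.sum_sub_distrib]
      ring
  simp_rw [h1]
  rw [integral_const_mul, torusMeasure_eq_pi,
    integral_fintype_prod_eq_prod
      (f := fun j (t : ℝ) => Complex.exp (-Complex.I * (((k j - n j : ℤ) : ℝ) * t : ℝ)))]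
  simp_rw [integral_exp_int]
  split_ifs with h
  · subst h
    simp only [sub_self, if_true, Finset.prod_const, Finset.card_univ, Fintype.card_fin]
    rw [← Complex.ofReal_pow, ← Complex.ofReal_mul, Real.rpow_neg (by positivity),
      Real.rpow_natCast, inv_mul_cancel₀ (by positivity), Complex.ofReal_one]
  · obtain ⟨j, hj⟩ := Function.ne_iff.mp h
    rw [Finset.prod_eq_zero (Finset.mem_univ j), mul_zero]
    rw [if_neg (sub_ne_zero.mpr hj.symm)]

theorem inner_character_smul {d m : ℕ} (n k : Fin d → ℤ) (v w : EuclideanSpace ℂ (Fin m)) :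
    inner ℂ (memLp_character_smul n v).toLp (memLp_character_smul k w).toLp =
      if n = k then inner ℂ v w else 0 := by
  have h : inner ℂ (memLp_character_smul n v).toLp (memLp_character_smul k w).toLp =
      ∫ x, ((starRingEnd ℂ) (character n x) * character k x) * inner ℂ v w ∂(torusMeasure d) := by
    rw [L2.inner_def]
    refine integral_congr_ae ?_
    filter_upwards [(memLp_character_smul n v).coeFn_toLp,
      (memLp_character_smul k w).coeFn_toLp] with x h1 h2
    rw [h1, h2, inner_smul_left, inner_smul_right]
    ring
  rw [h, integral_mul_const, integral_conj_character_mul]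
  split_ifs <;> simp

/-- The isometric embedding of `ℂ^m` into `L₂(𝕋^d, ℂ^m)`, `v ↦ (2π)^(-d/2) exp(-i n·x) v`. -/
def fourierMode {d : ℕ} (m : ℕ) (n : Fin d → ℤ) :
    EuclideanSpace ℂ (Fin m) →ₗᵢ[ℂ] FunSpace d m :=
  LinearMap.isometryOfInner
    { toFun := fun v => (memLp_character_smul n v).toLp
      map_add' := fun v w => by
        rw [← MemLp.toLp_add]
        exact MemLp.toLp_congr _ _ (Eventually.of_forall fun x => smul_add _ _ _)
      map_smul' := fun c v => by
        rw [RingHom.id_apply, ← MemLp.toLp_const_smul]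
        exact MemLp.toLp_congr _ _ (Eventually.of_forall fun x => smul_comm _ _ _) }
    (fun v w => by
      simpa using inner_character_smul n n v w)

theorem orthogonalFamily_fourierMode (d m : ℕ) :
    OrthogonalFamily ℂ (fun _ : Fin d → ℤ => EuclideanSpace ℂ (Fin m))
      (fun n => fourierMode m n) := by
  intro n k hnk v w
  exact (inner_character_smul n k v w).trans (if_neg hnk)

/-- The discrete Fourier transform `Φ : ℓ₂(ℤ^d, ℂ^m) → L₂(𝕋^d, ℂ^m)`,
`(Φ u)(x) = (2π)^(-d/2) ∑ₙ exp(-i n·x) u(n)`, the series being convergent in `L₂`. -/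
def discreteFourier (d m : ℕ) : SeqSpace d m →ₗᵢ[ℂ] FunSpace d m :=
  (orthogonalFamily_fourierMode d m).linearIsometry

theorem hasSum_discreteFourier {d m : ℕ} (u : SeqSpace d m) :
    HasSum (fun n => (memLp_character_smul n (u n)).toLp) (discreteFourier d m u) :=
  (orthogonalFamily_fourierMode d m).hasSum_linearIsometry u

/-- `A` is the operator `f Φ W`, defined on the whole of `ℓ₂(ℤ^d, ℂ^m₃)`: for every `u`,
the sequence `W u : n ↦ W(n) u(n)` is in `ℓ₂`, and `(A u)(x) = f(x) (Φ (W u))(x)` for almost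
every `x ∈ 𝕋^d`. -/
def IsBorderedFourier {d m₁ m₂ m₃ : ℕ} (f : (Fin d → ℝ) → Matrix (Fin m₁) (Fin m₂) ℂ)
    (W : (Fin d → ℤ) → Matrix (Fin m₂) (Fin m₃) ℂ)
    (A : SeqSpace d m₃ →L[ℂ] FunSpace d m₁) : Prop :=
  ∀ u : SeqSpace d m₃, ∃ w : SeqSpace d m₂,
    (∀ n, w n = WithLp.toLp 2 (W n *ᵥ (u n).ofLp)) ∧
    ∀ᵐ x ∂(torusMeasure d),
      A u x = WithLp.toLp 2 (f x *ᵥ (discreteFourier d m₂ w x).ofLp)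

end Cwikel

end

/-!
The singular numbers are counted directly, without interpolation and without inequalities for the
singular numbers of a sum. On the span of the eigenvectors of `|A|` with eigenvalues above `s` one
has `‖A u‖ ≥ s ‖u‖`, so `n(s, A)` is at most `m₃ |S|` plus the size of an orthonormal system in
this span whose members vanish on the finite set `S ⊂ ℤ^d` (`singularCount_le_of_orthonormal`).

For `A = f Φ W` the size of such a system is bounded by an energy estimate (`sum_lintegral_le`).
Fix a threshold `τ`. At a point `x` with `2 ^ (k - 1) < |f(x)| ≤ 2 ^ k` the sequence `W u` is split
into the finitely many indices with `2 ^ k |W(n)| > τ` and the rest.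

* The near part is a finite Fourier sum, and Bessel's inequality at each point `x` bounds its energy
  by the integral `overlapEnergy` of `|f(x)|² |W(n)|²` over the pairs with `2 |f(x)| |W(n)| > τ`.
* The far part is `f(x)` times the value at `x` of the transform of a sequence depending on `k`.
  Summing the squared `L₂` norms over all `k ∈ ℤ`, and not only over the slice of `x` belonging to
  `k`, removes the dependence on `x`; since `Φ` is an isometry the result is a geometric sum for
  each `n`, of order `τ² ‖u‖²` (`tsum_far_le`).

With `τ = s / 4` this gives `n(s, A) ≤ m₃ |S| + 4 m₂ E / s²`, where `E` is the overlap energy off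
`S` (`singularCount_le_overlapEnergy`). Take `S = {|W| > s / a}` with `a` the norm of `f` in `L_r`.
The weak-type bound on `W` controls `|S|`, and dyadic summation controls the sum of `|W(n)|²` over
`τ / (2 |f(x)|) < |W(n)| ≤ s / a` by a multiple of `|f(x)| ^ (r - 2)`. This requires
either `p < r` and `2 ≤ r`, or `2 < r = p`; such an exponent `r ≤ q` exists in each of the three
cases (`exists_exponent`), and for `p = 2` the upper cut removes the logarithmic divergence. With
`b` the weak norm of `W` the outcome is `n(s, A) ≤ C (a b / s) ^ p` (`exists_singularCount_le`).

The same energy estimate gives boundedness, and compactness because the overlap energy off large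
finite sets is small. If `W` is in the small class, its weak norm off a suitable finite set `T` is
arbitrarily small, and discarding `T` adds only the constant `m₃ |T|` to the count.
-/

noncomputable section

namespace Cwikel

/-! ### Counting singular numbers -/

/-- A finite dimensional subspace contains an orthonormal system annihilated by a linear map `L`
whose size falls short of the dimension by at most the dimension of the target of `L`. -/
theorem exists_orthonormal_in_ker {H G : Type*} [NormedAddCommGroup H]
    [InnerProductSpace ℂ H] [AddCommGroup G] [Module ℂ G]
    [FiniteDimensional ℂ G] (L : H →ₗ[ℂ] G) (F : Submodule ℂ H) [FiniteDimensional ℂ F] :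
    ∃ (M : ℕ) (e : Fin M → H), Orthonormal ℂ e ∧ (∀ i, e i ∈ F) ∧ (∀ i, L (e i) = 0) ∧
      Module.finrank ℂ F ≤ Module.finrank ℂ G + M := by
  set R : F →ₗ[ℂ] G := L.domRestrict F
  let b := stdOrthonormalBasis ℂ (LinearMap.ker R)
  refine ⟨_, fun i => ((b i : F) : H), ?_, fun i => (b i : F).2, fun i => ?_, ?_⟩
  · exact (b.orthonormal.comp_linearIsometry (LinearMap.ker R).subtypeₗᵢ).comp_linearIsometry
      F.subtypeₗᵢ
  · exact LinearMap.mem_ker.mp (b i).2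
  · have h1 := R.finrank_range_add_finrank_ker
    have h2 : Module.finrank ℂ (LinearMap.range R) ≤ Module.finrank ℂ G :=
      Submodule.finrank_le _
    omega

section Count

variable {H₁ H₂ : Type*} [NormedAddCommGroup H₁] [InnerProductSpace ℂ H₁] [CompleteSpace H₁]
  [NormedAddCommGroup H₂] [InnerProductSpace ℂ H₂] [CompleteSpace H₂]

theorem isSelfAdjoint_modulus (A : H₁ →L[ℂ] H₂) : IsSelfAdjoint (modulus A) :=
  (CFC.sqrt_nonneg (ContinuousLinearMap.adjoint A ∘L A)).isSelfAdjoint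

theorem norm_modulus_apply (A : H₁ →L[ℂ] H₂) (u : H₁) : ‖modulus A u‖ = ‖A u‖ := by
  have hnn : (0 : H₁ →L[ℂ] H₁) ≤ ContinuousLinearMap.adjoint A ∘L A := by
    rw [ContinuousLinearMap.nonneg_iff_isPositive]
    exact ContinuousLinearMap.isPositive_adjoint_comp_self A
  have hsq : modulus A * modulus A = ContinuousLinearMap.adjoint A ∘L A :=
    CFC.sqrt_mul_sqrt_self _ hnn
  have h1 : inner ℂ (modulus A u) (modulus A u) = inner ℂ (A u) (A u) := by
    have hadj : ContinuousLinearMap.adjoint (modulus A) = modulus A :=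
      (isSelfAdjoint_modulus A).adjoint_eq
    rw [← ContinuousLinearMap.adjoint_inner_right, hadj,
      ← ContinuousLinearMap.adjoint_inner_right]
    congr 1
    exact congrArg (fun T : H₁ →L[ℂ] H₁ => T u) hsq
  rw [inner_self_eq_norm_sq_to_K, inner_self_eq_norm_sq_to_K] at h1
  have h2 : ‖modulus A u‖ ^ 2 = ‖A u‖ ^ 2 := by exact_mod_cast h1
  exact (pow_left_inj₀ (norm_nonneg _) (norm_nonneg _) two_ne_zero).mp h2

theorem mul_norm_le_of_mem_iSup_eigenspace (A : H₁ →L[ℂ] H₂) {s : ℝ} (hs : 0 ≤ s) {u : H₁}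
    (hu : u ∈ (⨆ (t : ℝ) (_ : s < t),
      Module.End.eigenspace (modulus A : H₁ →ₗ[ℂ] H₁) (t : ℂ) : Submodule ℂ H₁)) :
    s * ‖u‖ ≤ ‖A u‖ := by
  rw [iSup_subtype', Submodule.mem_iSup_iff_exists_finsupp] at hu
  obtain ⟨g, hg, rfl⟩ := hu
  have hsymm : (modulus A : H₁ →ₗ[ℂ] H₁).IsSymmetric :=
    (isSelfAdjoint_modulus A).isSymmetric
  have horth := hsymm.orthogonalFamily_eigenspaces.comp
    (f := fun t : {t : ℝ // s < t} => ((t : ℝ) : ℂ))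
    (fun a b hab => Subtype.ext (Complex.ofReal_injective hab))
  have h1 : ‖g.sum fun _ xi => xi‖ ^ 2 = ∑ t ∈ g.support, ‖g t‖ ^ 2 :=
    horth.norm_sum (fun t => (⟨g t, hg t⟩ :
      Module.End.eigenspace (modulus A : H₁ →ₗ[ℂ] H₁) ((t : ℝ) : ℂ))) g.support
  have h2 : modulus A (g.sum fun _ xi => xi) = ∑ t ∈ g.support, ((t : ℝ) : ℂ) • g t := by
    rw [Finsupp.sum, map_sum]
    exact Finset.sum_congr rfl fun t _ => Module.End.mem_eigenspace_iff.mp (hg t)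
  have h3 : ‖modulus A (g.sum fun _ xi => xi)‖ ^ 2 =
      ∑ t ∈ g.support, ‖((t : ℝ) : ℂ) • g t‖ ^ 2 := by
    rw [h2]
    exact horth.norm_sum (fun t => ((t : ℝ) : ℂ) • (⟨g t, hg t⟩ :
      Module.End.eigenspace (modulus A : H₁ →ₗ[ℂ] H₁) ((t : ℝ) : ℂ))) g.support
  rw [← norm_modulus_apply]
  refine le_of_sq_le_sq ?_ (norm_nonneg _)
  rw [mul_pow, h1, h3, Finset.mul_sum]
  refine Finset.sum_le_sum fun t _ => ?_
  rw [norm_smul, mul_pow, Complex.norm_real, Real.norm_eq_abs, sq_abs]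
  have := t.2.le
  gcongr

/-- On the span of the eigenvectors of `|A|` with eigenvalues above `s` one has `‖A u‖ ≥ s ‖u‖`.
A bound on the size of orthonormal systems in the kernel of `L` with this property therefore bounds
`n(s, A)`, up to the rank of `L`. -/
theorem singularCount_le_of_orthonormal {G : Type*} [AddCommGroup G] [Module ℂ G]
    [FiniteDimensional ℂ G] (A : H₁ →L[ℂ] H₂) (L : H₁ →ₗ[ℂ] G) {s : ℝ} (hs : 0 ≤ s) {K : ℝ≥0∞}
    (h : ∀ (M : ℕ) (e : Fin M → H₁), Orthonormal ℂ e → (∀ i, L (e i) = 0) →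
      (∀ i, s ≤ ‖A (e i)‖) → (M : ℝ≥0∞) ≤ K) :
    (singularCount s A : ℝ≥0∞) ≤ (Module.finrank ℂ G : ℝ≥0∞) + K := by
  set V : Submodule ℂ H₁ := ⨆ (t : ℝ) (_ : s < t),
      Module.End.eigenspace (modulus A : H₁ →ₗ[ℂ] H₁) (t : ℂ) with hV
  have key : ∀ n : ℕ, (n : ℕ∞) ≤ singularCount s A →
      (n : ℝ≥0∞) ≤ (Module.finrank ℂ G : ℝ≥0∞) + K := by
    intro n hn
    have hn' : (n : Cardinal) ≤ Module.rank ℂ V := Cardinal.natCast_le_toENat.mp hn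
    obtain ⟨v, hv⟩ := Module.le_rank_iff.mp hn'
    have hv' : LinearIndependent ℂ (fun i => (v i : H₁)) :=
      hv.map' V.subtype V.ker_subtype
    set F : Submodule ℂ H₁ := Submodule.span ℂ (Set.range fun i => (v i : H₁))
    have hFV : F ≤ V := by
      rw [Submodule.span_le]
      rintro _ ⟨i, rfl⟩
      exact (v i).2
    have hfd : FiniteDimensional ℂ F := FiniteDimensional.span_of_finite ℂ (Set.finite_range _)
    obtain ⟨M, e, he, heF, heL, hM⟩ := exists_orthonormal_in_ker L F
    have hdim : Module.finrank ℂ F = n := by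
      simpa using finrank_span_eq_card hv'
    have hK := h M e he heL fun i => by
      have := mul_norm_le_of_mem_iSup_eigenspace A hs (hFV (heF i))
      rwa [he.1 i, mul_one] at this
    rw [hdim] at hM
    calc (n : ℝ≥0∞) ≤ ((Module.finrank ℂ G + M : ℕ) : ℝ≥0∞) := by exact_mod_cast hM
      _ = (Module.finrank ℂ G : ℝ≥0∞) + M := by push_cast; rfl
      _ ≤ _ := by gcongr
  generalize singularCount s A = c at key ⊢
  cases c with
  | top =>
    have : (Module.finrank ℂ G : ℝ≥0∞) + K = ∞ := by
      by_contra hne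
      obtain ⟨n, hn⟩ := ENNReal.exists_nat_gt hne
      exact absurd (key n le_top) (not_le.mpr hn)
    rw [this]
    exact le_top
  | coe n => simpa using key n le_rfl

end Count

/-! ### Matrix weights -/

/-- The sum of the absolute values of the entries; it dominates the `ℓ₂` operator norm. -/
def entrySum {m n : ℕ} (M : Matrix (Fin m) (Fin n) ℂ) : ℝ≥0 := ∑ i, ∑ j, ‖M i j‖₊

/-- A matrix as an operator between Euclidean spaces. -/
def matCLM {m n : ℕ} (M : Matrix (Fin m) (Fin n) ℂ) :
    EuclideanSpace ℂ (Fin n) →L[ℂ] EuclideanSpace ℂ (Fin m) :=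
  LinearMap.toContinuousLinearMap (Matrix.toLpLin 2 2 M)

theorem matCLM_apply {m n : ℕ} (M : Matrix (Fin m) (Fin n) ℂ) (v : EuclideanSpace ℂ (Fin n)) :
    matCLM M v = WithLp.toLp 2 (M *ᵥ v.ofLp) := rfl

@[simp]
theorem matCLM_zero {m n : ℕ} : matCLM (0 : Matrix (Fin m) (Fin n) ℂ) = 0 := by
  simp [matCLM]

theorem norm_le_sum_norm_coord {m : ℕ} (v : EuclideanSpace ℂ (Fin m)) : ‖v‖ ≤ ∑ i, ‖v i‖ := by
  conv_lhs => rw [← (EuclideanSpace.basisFun (Fin m) ℂ).sum_repr v]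
  refine (norm_sum_le _ _).trans (Finset.sum_le_sum fun i _ => ?_)
  rw [norm_smul, OrthonormalBasis.norm_eq_one, mul_one]
  simp

theorem norm_matCLM_apply_le {m n : ℕ} (M : Matrix (Fin m) (Fin n) ℂ)
    (v : EuclideanSpace ℂ (Fin n)) : ‖matCLM M v‖ ≤ entrySum M * ‖v‖ := by
  refine (norm_le_sum_norm_coord _).trans ?_
  have : ((entrySum M : ℝ≥0) : ℝ) = ∑ i, ∑ j, ‖M i j‖ := by simp [entrySum]
  rw [this, Finset.sum_mul]
  refine Finset.sum_le_sum fun i _ => ?_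
  rw [matCLM_apply, Finset.sum_mul]
  simp only [Matrix.mulVec, dotProduct]
  refine (norm_sum_le _ _).trans (Finset.sum_le_sum fun j _ => ?_)
  rw [norm_mul]
  gcongr
  exact PiLp.norm_apply_le v j

theorem nnnorm_matCLM_apply_le {m n : ℕ} (M : Matrix (Fin m) (Fin n) ℂ)
    (v : EuclideanSpace ℂ (Fin n)) : ‖matCLM M v‖₊ ≤ entrySum M * ‖v‖₊ :=
  norm_matCLM_apply_le M v

theorem enorm_matCLM_apply_le {m n : ℕ} (M : Matrix (Fin m) (Fin n) ℂ)
    (v : EuclideanSpace ℂ (Fin n)) : ‖matCLM M v‖ₑ ≤ entrySum M * ‖v‖ₑ := by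
  simp only [enorm_eq_nnnorm]
  exact_mod_cast nnnorm_matCLM_apply_le M v

section Seq

variable {d m m' : ℕ}

theorem enorm_sq_eq_tsum (u : SeqSpace d m) : ‖u‖ₑ ^ 2 = ∑' n, ‖u n‖ₑ ^ 2 := by
  have h1 : HasSum (fun n => ‖u n‖ ^ (2 : ℝ)) (‖u‖ ^ (2 : ℝ)) := by
    simpa using lp.hasSum_norm (p := 2) (by simp) u
  have h2 : HasSum (fun n => ‖u n‖₊ ^ 2) (‖u‖₊ ^ 2) := by
    rw [← NNReal.hasSum_coe]
    simpa using h1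
  simp only [enorm_eq_nnnorm]
  have := ENNReal.hasSum_coe.mpr h2
  simpa using this.tsum_eq.symm

theorem sum_norm_sq_le (u : SeqSpace d m) (N : Finset (Fin d → ℤ)) :
    ∑ n ∈ N, ‖u n‖ ^ 2 ≤ ‖u‖ ^ 2 := by
  simpa using lp.sum_rpow_le_norm_rpow (p := 2) (by simp) u N

theorem memlp_weight {W : (Fin d → ℤ) → Matrix (Fin m) (Fin m') ℂ}
    (hW : BddAbove (Set.range fun n => entrySum (W n))) (u : SeqSpace d m') :
    Memℓp (fun n => matCLM (W n) (u n)) 2 := by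
  obtain ⟨B, hB⟩ := hW
  have hu : Summable fun n => ‖u n‖ ^ (2 : ℝ≥0∞).toReal := (lp.memℓp u).summable (by simp)
  refine memℓp_gen ((hu.mul_left ((B : ℝ) ^ (2 : ℝ≥0∞).toReal)).of_nonneg_of_le
    (fun n => by positivity) fun n => ?_)
  rw [← Real.mul_rpow B.coe_nonneg (norm_nonneg _)]
  refine Real.rpow_le_rpow (norm_nonneg _) ((norm_matCLM_apply_le _ _).trans ?_) (by simp)
  gcongr
  exact hB ⟨n, rfl⟩

/-- The diagonal operator `(W u)(n) = W(n) u(n)` on `ℓ₂` with a bounded weight. -/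
def weightCLM (W : (Fin d → ℤ) → Matrix (Fin m) (Fin m') ℂ)
    (hW : BddAbove (Set.range fun n => entrySum (W n))) : SeqSpace d m' →L[ℂ] SeqSpace d m :=
  LinearMap.mkContinuousOfExistsBound
    { toFun := fun u => ⟨fun n => matCLM (W n) (u n), memlp_weight hW u⟩
      map_add' := fun u v => lp.ext (funext fun n => map_add (matCLM (W n)) (u n) (v n))
      map_smul' := fun c u => lp.ext (funext fun n => map_smul (matCLM (W n)) c (u n)) }
    (by
      obtain ⟨B, hB⟩ := hW
      refine ⟨B, fun u => ?_⟩
      refine lp.norm_le_of_forall_sum_le (p := 2) (by simp) (by positivity) fun N => ?_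
      simp only [ENNReal.toReal_ofNat, Real.rpow_ofNat]
      calc ∑ n ∈ N, ‖matCLM (W n) (u n)‖ ^ 2 ≤ ∑ n ∈ N, (B * ‖u n‖) ^ 2 := by
            refine Finset.sum_le_sum fun n _ => ?_
            have : entrySum (W n) ≤ B := hB ⟨n, rfl⟩
            have h2 : (entrySum (W n) : ℝ) ≤ B := this
            have h3 := norm_matCLM_apply_le (W n) (u n)
            gcongr
            exact h3.trans (by gcongr)
        _ = B ^ 2 * ∑ n ∈ N, ‖u n‖ ^ 2 := by simp_rw [mul_pow, Finset.mul_sum]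
        _ ≤ (B * ‖u‖) ^ 2 := by
            rw [mul_pow]
            gcongr
            exact sum_norm_sq_le u N)

@[simp]
theorem weightCLM_apply (W : (Fin d → ℤ) → Matrix (Fin m) (Fin m') ℂ)
    (hW : BddAbove (Set.range fun n => entrySum (W n))) (u : SeqSpace d m') (n : Fin d → ℤ) :
    weightCLM W hW u n = matCLM (W n) (u n) := rfl

end Seq

/-! ### Bessel inequalities -/

/-- The Bessel inequality with constant `M`, transported through an operator into `ℂ^m`: each
coordinate functional of `L` is represented by a vector of norm at most `‖L‖`. -/
theorem sum_norm_sq_apply_le_of_bessel {H : Type*} [NormedAddCommGroup H] [InnerProductSpace ℂ H]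
    [CompleteSpace H] {m : ℕ} (L : H →L[ℂ] EuclideanSpace ℂ (Fin m)) {ι : Type*} [Fintype ι]
    {e : ι → H} {M : ℝ} (hM0 : 0 ≤ M) (hM : ∀ y, ∑ i, ‖inner ℂ y (e i)‖ ^ 2 ≤ M * ‖y‖ ^ 2) :
    ∑ i, ‖L (e i)‖ ^ 2 ≤ m * M * ‖L‖ ^ 2 := by
  let b := EuclideanSpace.basisFun (Fin m) ℂ
  calc ∑ i, ‖L (e i)‖ ^ 2
      = ∑ i, ∑ j, ‖inner ℂ (ContinuousLinearMap.adjoint L (b j)) (e i)‖ ^ 2 := by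
        refine Finset.sum_congr rfl fun i _ => ?_
        rw [← b.sum_sq_norm_inner_right]
        simp_rw [ContinuousLinearMap.adjoint_inner_left]
    _ = ∑ j, ∑ i, ‖inner ℂ (ContinuousLinearMap.adjoint L (b j)) (e i)‖ ^ 2 := Finset.sum_comm
    _ ≤ ∑ _j : Fin m, M * ‖L‖ ^ 2 := by
        refine Finset.sum_le_sum fun j _ => (hM _).trans ?_
        gcongr
        refine (ContinuousLinearMap.le_opNorm _ _).trans ?_
        rw [LinearIsometryEquiv.norm_map, b.norm_eq_one, mul_one]
    _ = m * M * ‖L‖ ^ 2 := by simp; ring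

section Near

variable {d m m' : ℕ}

theorem sum_norm_sq_weighted_le {W : (Fin d → ℤ) → Matrix (Fin m) (Fin m') ℂ}
    {a : (Fin d → ℤ) → ℂ} (ha : ∀ n, ‖a n‖ ≤ 1) (N : Finset (Fin d → ℤ)) {ι : Type*} [Fintype ι]
    {e : ι → SeqSpace d m'} {M : ℝ} (hM0 : 0 ≤ M)
    (hM : ∀ y, ∑ i, ‖inner ℂ y (e i)‖ ^ 2 ≤ M * ‖y‖ ^ 2) :
    ∑ i, ‖∑ n ∈ N, a n • matCLM (W n) (e i n)‖ ^ 2 ≤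
      m * M * ∑ n ∈ N, (entrySum (W n) : ℝ) ^ 2 := by
  let L : SeqSpace d m' →L[ℂ] EuclideanSpace ℂ (Fin m) :=
    ∑ n ∈ N, a n • (matCLM (W n) ∘L lp.evalCLM ℂ (fun _ => EuclideanSpace ℂ (Fin m')) 2 n)
  have hL : ∀ u, L u = ∑ n ∈ N, a n • matCLM (W n) (u n) := fun u => by
    simp only [L, sum_apply]; rfl
  have hLn : ‖L‖ ≤ √(∑ n ∈ N, (entrySum (W n) : ℝ) ^ 2) := by
    refine L.opNorm_le_bound (Real.sqrt_nonneg _) fun u => ?_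
    rw [hL]
    calc ‖∑ n ∈ N, a n • matCLM (W n) (u n)‖ ≤ ∑ n ∈ N, (entrySum (W n) : ℝ) * ‖u n‖ := by
          refine (norm_sum_le _ _).trans (Finset.sum_le_sum fun n _ => ?_)
          rw [norm_smul]
          exact (mul_le_of_le_one_left (norm_nonneg _) (ha n)).trans (norm_matCLM_apply_le _ _)
      _ ≤ √(∑ n ∈ N, (entrySum (W n) : ℝ) ^ 2) * √(∑ n ∈ N, ‖u n‖ ^ 2) :=
          Real.sum_mul_le_sqrt_mul_sqrt _ _ _
      _ ≤ _ := by
          gcongr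
          rw [Real.sqrt_le_left (norm_nonneg _)]
          exact sum_norm_sq_le u N
  have h := sum_norm_sq_apply_le_of_bessel L hM0 hM
  simp_rw [hL] at h
  refine h.trans ?_
  gcongr
  rw [← Real.sq_sqrt (show 0 ≤ ∑ n ∈ N, (entrySum (W n) : ℝ) ^ 2 by positivity)]
  gcongr

end Near

/-! ### A geometric sum over dyadic scales -/

/-- The scales `2 ^ k`, `k ∈ ℤ`, with `2 ^ k v ≤ τ` have `∑ (2 ^ k v)² ≤ 2 τ²`. -/
theorem tsum_dyadic_le (τ v : ℝ≥0) :
    ∑' k : ℤ, (if τ < 2 ^ k * v then (0 : ℝ≥0∞) else ((2 ^ k * v : ℝ≥0) : ℝ≥0∞) ^ 2) ≤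
      2 * (τ : ℝ≥0∞) ^ 2 := by
  rcases eq_or_ne v 0 with rfl | hv
  · simp
  rcases eq_or_ne τ 0 with rfl | hτ
  · have : ∀ k : ℤ, (0 : ℝ≥0) < 2 ^ k * v := fun k => by positivity
    simp [this]
  obtain ⟨k₀, hk₀⟩ := exists_mem_Ico_zpow (x := τ / v) (y := 2) (by positivity) one_lt_two
  have hinj : Function.Injective fun j : ℕ => k₀ - j := fun a b h => by simpa using h
  rw [← hinj.tsum_eq]
  · have hterm : ∀ j : ℕ, (if τ < 2 ^ (k₀ - j) * v then (0 : ℝ≥0∞)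
        else ((2 ^ (k₀ - j) * v : ℝ≥0) : ℝ≥0∞) ^ 2) ≤ (τ : ℝ≥0∞) ^ 2 * 2⁻¹ ^ j := by
      intro j
      have h1 : (2 : ℝ≥0) ^ (k₀ - j) * v ≤ τ * 2⁻¹ ^ j := by
        rw [zpow_sub₀ two_ne_zero, zpow_natCast, inv_pow, div_eq_mul_inv, mul_right_comm]
        gcongr
        exact (le_div_iff₀ (by positivity)).mp hk₀.1
      have h2 : ((2 : ℝ≥0) ^ (k₀ - j) * v) ^ 2 ≤ τ ^ 2 * 2⁻¹ ^ j := by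
        calc ((2 : ℝ≥0) ^ (k₀ - j) * v) ^ 2 ≤ (τ * 2⁻¹ ^ j) ^ 2 := by gcongr
          _ = τ ^ 2 * 2⁻¹ ^ j * 2⁻¹ ^ j := by ring
          _ ≤ τ ^ 2 * 2⁻¹ ^ j := mul_le_of_le_one_right (by positivity)
              (pow_le_one₀ (by positivity) (by
                rw [inv_le_one₀ two_pos]; exact one_le_two))
      have h3 : ((τ ^ 2 * 2⁻¹ ^ j : ℝ≥0) : ℝ≥0∞) = (τ : ℝ≥0∞) ^ 2 * 2⁻¹ ^ j := by
        rw [ENNReal.coe_mul, ENNReal.coe_pow, ENNReal.coe_pow, ENNReal.coe_inv two_ne_zero,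
          ENNReal.coe_ofNat]
      split_ifs
      · exact zero_le
      · rw [← h3, ← ENNReal.coe_pow]
        exact ENNReal.coe_le_coe.mpr h2
    refine (ENNReal.tsum_le_tsum hterm).trans_eq ?_
    rw [ENNReal.tsum_mul_left, ENNReal.tsum_geometric, ENNReal.one_sub_inv_two, inv_inv, mul_comm]
  · intro k hk
    have hk' : 2 ^ k * v ≤ τ := by
      by_contra hcon
      exact hk (if_pos (not_le.mp hcon))
    have h5 : (2 : ℝ≥0) ^ k < 2 ^ (k₀ + 1) :=
      ((le_div_iff₀ (by positivity)).mpr hk').trans_lt hk₀.2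
    have h6 : k < k₀ + 1 := (zpow_lt_zpow_iff_right₀ one_lt_two).mp h5
    exact ⟨(k₀ - k).toNat, by simp; omega⟩

/-! ### The energy estimate -/

section Measurability

variable {X : Type*} [MeasurableSpace X] {μ : Measure X} {m n : ℕ}

theorem aestronglyMeasurable_matCLM_apply {f : X → Matrix (Fin m) (Fin n) ℂ}
    (hf : ∀ i j, AEStronglyMeasurable (fun x => f x i j) μ)
    {g : X → EuclideanSpace ℂ (Fin n)} (hg : AEStronglyMeasurable g μ) :
    AEStronglyMeasurable (fun x => matCLM (f x) (g x)) μ := by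
  simp only [matCLM_apply]
  refine (PiLp.continuous_toLp 2 _).comp_aestronglyMeasurable ?_
  refine (aemeasurable_pi_iff.mpr fun i => ?_).aestronglyMeasurable
  simp only [Matrix.mulVec, dotProduct]
  refine Finset.aemeasurable_fun_sum _ fun j _ => (hf i j).aemeasurable.mul ?_
  exact ((PiLp.continuous_apply 2 _ j).comp_aestronglyMeasurable hg).aemeasurable

theorem aemeasurable_entrySum {f : X → Matrix (Fin m) (Fin n) ℂ}
    (hf : ∀ i j, AEStronglyMeasurable (fun x => f x i j) μ) :
    AEMeasurable (fun x => entrySum (f x)) μ := by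
  unfold entrySum
  exact Finset.aemeasurable_fun_sum _ fun i _ =>
    Finset.aemeasurable_fun_sum _ fun j _ => (hf i j).nnnorm.aemeasurable

end Measurability

theorem bddAbove_entrySum_indicator {d m m' : ℕ} {W : (Fin d → ℤ) → Matrix (Fin m) (Fin m') ℂ}
    (hW : BddAbove (Set.range fun n => entrySum (W n))) (S : Set (Fin d → ℤ)) :
    BddAbove (Set.range fun n => entrySum (S.indicator W n)) := by
  obtain ⟨B, hB⟩ := hW
  refine ⟨B, ?_⟩
  rintro _ ⟨n, rfl⟩
  by_cases hn : n ∈ S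
  · simpa [hn] using hB ⟨n, rfl⟩
  · simp [hn, entrySum]

theorem norm_character_le_one {d : ℕ} (n : Fin d → ℤ) (x : Fin d → ℝ) : ‖character n x‖ ≤ 1 := by
  rw [norm_character]
  refine Real.rpow_le_one_of_one_le_of_nonpos (by linarith [Real.pi_gt_three]) ?_
  rw [neg_div, neg_nonpos]
  positivity

theorem lintegral_enorm_sq_eq {d m : ℕ} (g : FunSpace d m) :
    ∫⁻ x, ‖g x‖ₑ ^ 2 ∂(torusMeasure d) = ‖g‖ₑ ^ 2 := by
  have h := eLpNorm_nnreal_pow_eq_lintegral (f := g) (μ := torusMeasure d) (p := 2) two_ne_zero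
  rw [Lp.enorm_def]
  simpa using h.symm

theorem discreteFourier_ae_eq_sum {d m : ℕ} (w : SeqSpace d m) (N : Finset (Fin d → ℤ))
    (hN : ∀ n ∉ N, w n = 0) :
    ∀ᵐ x ∂(torusMeasure d), discreteFourier d m w x = ∑ n ∈ N, character n x • w n := by
  have h1 : discreteFourier d m w = ∑ n ∈ N, (memLp_character_smul n (w n)).toLp := by
    refine (hasSum_discreteFourier w).unique (hasSum_sum_of_ne_finset_zero fun n hn => ?_)
    have := hN n hn
    exact (map_zero (fourierMode m n)) ▸ congrArg (fourierMode m n) this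
  rw [h1]
  have h2 : ∀ᵐ x ∂(torusMeasure d), ∀ n ∈ N,
      (memLp_character_smul n (w n)).toLp _ x = character n x • w n :=
    (Finset.eventually_all N).mpr fun n _ => (memLp_character_smul n (w n)).coeFn_toLp
  filter_upwards [Lp.coeFn_finsetSum N fun n => (memLp_character_smul n (w n)).toLp, h2]
    with x hx hx2
  rw [hx, Finset.sum_apply]
  exact Finset.sum_congr rfl hx2

/-- The contribution `(t v)²` of a pair of values `t = |f(x)|`, `v = |W(n)|` whose product is not
small compared with the threshold `τ`. -/
def gain (τ t v : ℝ≥0) : ℝ≥0∞ := if τ < 2 * (t * v) then ((t * v : ℝ≥0) : ℝ≥0∞) ^ 2 else 0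

theorem measurable_gain (τ v : ℝ≥0) : Measurable fun t => gain τ t v := by
  unfold gain
  refine Measurable.ite (measurableSet_lt measurable_const (by fun_prop)) (by fun_prop)
    measurable_const

/-- The integral of `|f(x)|² |W(n)|²` over those pairs `(x, n)`, `n ∉ S`, for which
`|f(x)| |W(n)|` is not small compared with `τ`: the squared Hilbert–Schmidt norm, up to constants,
of the part of `f Φ W` living on these pairs. -/
def overlapEnergy {d m₁ m₂ m₃ : ℕ} (f : (Fin d → ℝ) → Matrix (Fin m₁) (Fin m₂) ℂ)
    (W : (Fin d → ℤ) → Matrix (Fin m₂) (Fin m₃) ℂ) (τ : ℝ≥0) (S : Set (Fin d → ℤ)) : ℝ≥0∞ :=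
  ∫⁻ x, ∑' n, Sᶜ.indicator (fun n => gain τ (entrySum (f x)) (entrySum (W n))) n ∂(torusMeasure d)

section Energy

variable {d m₁ m₂ m₃ : ℕ} {f : (Fin d → ℝ) → Matrix (Fin m₁) (Fin m₂) ℂ}
  {W : (Fin d → ℤ) → Matrix (Fin m₂) (Fin m₃) ℂ}

/-- The indices on which the product of `|W|` with the scale `2 ^ k` exceeds `τ`. -/
def nearSet (W : (Fin d → ℤ) → Matrix (Fin m₂) (Fin m₃) ℂ) (τ : ℝ≥0) (k : ℤ) :
    Set (Fin d → ℤ) := {n | τ < 2 ^ k * entrySum (W n)}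

theorem finite_nearSet (hfin : ∀ ε : ℝ≥0, 0 < ε → {n | ε < entrySum (W n)}.Finite) {τ : ℝ≥0}
    (hτ : 0 < τ) (k : ℤ) : (nearSet W τ k).Finite := by
  refine (hfin (τ / 2 ^ k) (by positivity)).subset fun n hn => ?_
  rw [Set.mem_ofPred_eq, div_lt_iff₀ (by positivity), mul_comm]
  exact hn

/-- The parts of `W u` far from each dyadic scale are summable against the squares of the scales:
each index `n` contributes a geometric sum with largest term at most `τ² |u(n)|²`. -/
theorem tsum_far_le (hW : BddAbove (Set.range fun n => entrySum (W n))) (τ : ℝ≥0)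
    (u : SeqSpace d m₃) :
    ∑' k : ℤ, ((2 ^ k : ℝ≥0) : ℝ≥0∞) ^ 2 *
      ‖weightCLM ((nearSet W τ k)ᶜ.indicator W) (bddAbove_entrySum_indicator hW _) u‖ₑ ^ 2 ≤
      2 * (τ : ℝ≥0∞) ^ 2 * ‖u‖ₑ ^ 2 := by
  simp_rw [enorm_sq_eq_tsum, ← ENNReal.tsum_mul_left]
  rw [ENNReal.tsum_comm]
  refine ENNReal.tsum_le_tsum fun n => ?_
  refine le_trans ?_ (mul_le_mul_left (tsum_dyadic_le τ (entrySum (W n))) _)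
  rw [← ENNReal.tsum_mul_right]
  refine ENNReal.tsum_le_tsum fun k => ?_
  rw [weightCLM_apply]
  by_cases hn : τ < 2 ^ k * entrySum (W n)
  · have : n ∉ (nearSet W τ k)ᶜ := fun h => h hn
    simp [this]
  · have : n ∈ (nearSet W τ k)ᶜ := hn
    rw [if_neg hn, Set.indicator_of_mem this, ← mul_pow, ← mul_pow, ENNReal.coe_mul, mul_assoc]
    gcongr
    exact enorm_matCLM_apply_le _ _

/-- The near part at a point where `|f(x)| = t`: by Bessel's inequality it is controlled by the
pairs `(x, n)` whose gain is positive. -/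
theorem sum_enorm_near_le {τ : ℝ≥0} {k : ℤ} (hk : (nearSet W τ k).Finite) {t : ℝ≥0}
    (ht : 2 ^ k < 2 * t) {ι : Type*} [Fintype ι] {e : ι → SeqSpace d m₃} {M : ℝ≥0}
    (hM : ∀ y, ∑ i, ‖inner ℂ y (e i)‖ ^ 2 ≤ M * ‖y‖ ^ 2) {S : Set (Fin d → ℤ)}
    (hS : ∀ i, ∀ n ∈ S, e i n = 0) (x : Fin d → ℝ) :
    (t : ℝ≥0∞) ^ 2 * ∑ i, ‖∑ n ∈ hk.toFinset, character n x • matCLM (W n) (e i n)‖ₑ ^ 2 ≤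
      m₂ * M * ∑' n, Sᶜ.indicator (fun n => gain τ t (entrySum (W n))) n := by
  classical
  set N := hk.toFinset.filter fun n => n ∉ S with hNdef
  have h0 : ∀ i, ∑ n ∈ hk.toFinset, character n x • matCLM (W n) (e i n) =
      ∑ n ∈ N, character n x • matCLM (W n) (e i n) := by
    intro i
    refine (Finset.sum_subset (Finset.filter_subset _ _) fun n hn hn' => ?_).symm
    have : n ∈ S := by
      by_contra hcon
      exact hn' (Finset.mem_filter.mpr ⟨hn, hcon⟩)
    rw [hS i n this, map_zero, smul_zero]
  simp_rw [h0]
  have h1 := sum_norm_sq_weighted_le (W := W) (a := fun n => character n x)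
    (fun n => norm_character_le_one n x) N M.coe_nonneg hM
  have h2 : ∑ i, ‖∑ n ∈ N, character n x • matCLM (W n) (e i n)‖ₑ ^ 2 ≤
      m₂ * M * ∑ n ∈ N, (entrySum (W n) : ℝ≥0∞) ^ 2 := by
    have h3 : ∑ i, ‖∑ n ∈ N, character n x • matCLM (W n) (e i n)‖₊ ^ 2 ≤
        m₂ * M * ∑ n ∈ N, (entrySum (W n)) ^ 2 := by
      rw [← NNReal.coe_le_coe]
      push_cast
      exact h1
    simp only [enorm_eq_nnnorm]
    exact_mod_cast h3
  calc _ ≤ (t : ℝ≥0∞) ^ 2 * (m₂ * M * ∑ n ∈ N, (entrySum (W n) : ℝ≥0∞) ^ 2) := by gcongr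
    _ = m₂ * M * ∑ n ∈ N, ((t * entrySum (W n) : ℝ≥0) : ℝ≥0∞) ^ 2 := by
        simp_rw [ENNReal.coe_mul, mul_pow, ← Finset.mul_sum]
        ring
    _ = m₂ * M * ∑ n ∈ N, Sᶜ.indicator (fun n => gain τ t (entrySum (W n))) n := by
        congr 1
        refine Finset.sum_congr rfl fun n hn => ?_
        obtain ⟨hn1, hn2⟩ := Finset.mem_filter.mp hn
        have hn3 : τ < 2 ^ k * entrySum (W n) := hk.mem_toFinset.mp hn1
        have hn4 : n ∈ Sᶜ := hn2
        rw [Set.indicator_of_mem hn4, gain, if_pos]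
        refine hn3.trans_le ?_
        rw [← mul_assoc]
        gcongr
    _ ≤ _ := by
        gcongr
        exact ENNReal.sum_le_tsum N

/-- The energy estimate. At a point `x` with `2 ^ (k - 1) < |f(x)| ≤ 2 ^ k`, the sequence `W u` is
split into the finitely many indices with `τ < 2 ^ k |W(n)|`, treated pointwise by Bessel's
inequality, and the remaining ones. For the latter the dependence of the splitting on `x` is removed
by summing over all scales `k ∈ ℤ`, after which `Φ` is used as an isometry. -/
theorem sum_lintegral_le
    (hf : ∀ i j, AEStronglyMeasurable (fun x => f x i j) (torusMeasure d))
    (hW : BddAbove (Set.range fun n => entrySum (W n)))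
    (hfin : ∀ ε : ℝ≥0, 0 < ε → {n | ε < entrySum (W n)}.Finite) {τ : ℝ≥0} (hτ : 0 < τ)
    {ι : Type*} [Fintype ι] (e : ι → SeqSpace d m₃) {M : ℝ≥0}
    (hM : ∀ y, ∑ i, ‖inner ℂ y (e i)‖ ^ 2 ≤ M * ‖y‖ ^ 2) {S : Set (Fin d → ℤ)}
    (hS : ∀ i, ∀ n ∈ S, e i n = 0) :
    ∑ i, ∫⁻ x, ‖matCLM (f x) (discreteFourier d m₂ (weightCLM W hW (e i)) x)‖ₑ ^ 2
        ∂(torusMeasure d) ≤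
      2 * (m₂ * M) * overlapEnergy f W τ S + 4 * (τ : ℝ≥0∞) ^ 2 * ∑ i, ‖e i‖ₑ ^ 2 := by
  classical
  let Tf : ℤ → SeqSpace d m₃ →L[ℂ] SeqSpace d m₂ := fun k =>
    weightCLM ((nearSet W τ k)ᶜ.indicator W) (bddAbove_entrySum_indicator hW _)
  let Tn : ℤ → SeqSpace d m₃ →L[ℂ] SeqSpace d m₂ := fun k =>
    weightCLM ((nearSet W τ k).indicator W) (bddAbove_entrySum_indicator hW _)
  have hsplit : ∀ k u, weightCLM W hW u = Tn k u + Tf k u := by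
    intro k u
    refine lp.ext (funext fun n => ?_)
    rw [lp.coeFn_add, Pi.add_apply]
    simp only [Tn, Tf, weightCLM_apply]
    by_cases hn : n ∈ nearSet W τ k <;> simp [hn]
  have hfar_meas : ∀ i k, AEMeasurable
      (fun x => ‖discreteFourier d m₂ (Tf k (e i)) x‖ₑ ^ 2) (torusMeasure d) := fun i k =>
    (Lp.aestronglyMeasurable _).enorm.pow_const 2
  have hpt : ∀ᵐ x ∂(torusMeasure d), ∀ i k, discreteFourier d m₂ (weightCLM W hW (e i)) x =
      ∑ n ∈ (finite_nearSet hfin hτ k).toFinset, character n x • matCLM (W n) (e i n) +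
        discreteFourier d m₂ (Tf k (e i)) x := by
    rw [ae_all_iff]; intro i
    rw [ae_all_iff]; intro k
    have h1 := discreteFourier_ae_eq_sum (Tn k (e i)) (finite_nearSet hfin hτ k).toFinset
      (fun n hn => by
        have hn' : n ∉ nearSet W τ k := fun h => hn ((Set.Finite.mem_toFinset _).mpr h)
        simp [Tn, hn'])
    have h2 : discreteFourier d m₂ (weightCLM W hW (e i)) =
        discreteFourier d m₂ (Tn k (e i)) + discreteFourier d m₂ (Tf k (e i)) := by
      rw [hsplit k, map_add]
    rw [h2]
    filter_upwards [h1, Lp.coeFn_add (discreteFourier d m₂ (Tn k (e i)))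
      (discreteFourier d m₂ (Tf k (e i)))] with x hx1 hx2
    rw [hx2, Pi.add_apply, hx1]
    congr 1
    refine Finset.sum_congr rfl fun n hn => ?_
    have hn' : n ∈ nearSet W τ k := (Set.Finite.mem_toFinset _).mp hn
    simp [Tn, hn']
  have hbound : ∀ᵐ x ∂(torusMeasure d),
      ∑ i, ‖matCLM (f x) (discreteFourier d m₂ (weightCLM W hW (e i)) x)‖ₑ ^ 2 ≤
        2 * (m₂ * M) * (∑' n, Sᶜ.indicator (fun n => gain τ (entrySum (f x)) (entrySum (W n))) n) +
        2 * ∑ i, ∑' k : ℤ, ((2 ^ k : ℝ≥0) : ℝ≥0∞) ^ 2 *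
          ‖discreteFourier d m₂ (Tf k (e i)) x‖ₑ ^ 2 := by
    filter_upwards [hpt] with x hx
    set t := entrySum (f x) with ht
    rcases eq_or_ne t 0 with h0 | h0
    · have : ∀ v, ‖matCLM (f x) v‖ₑ = 0 := fun v => by
        have := enorm_matCLM_apply_le (f x) v
        rw [← ht, h0, ENNReal.coe_zero, zero_mul] at this
        exact le_antisymm this zero_le
      simp [this]
    obtain ⟨k₀, hk₀⟩ := exists_mem_Ioc_zpow (x := t) (y := 2) (pos_iff_ne_zero.mpr h0) one_lt_two
    set k := k₀ + 1
    have hk1 : (2 : ℝ≥0) ^ k < 2 * t := by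
      rw [zpow_add_one₀ two_ne_zero, mul_comm]
      gcongr
      exact hk₀.1
    have hk2 : (t : ℝ≥0∞) ≤ ((2 ^ k : ℝ≥0) : ℝ≥0∞) := ENNReal.coe_le_coe.mpr hk₀.2
    have hi : ∀ i, ‖matCLM (f x) (discreteFourier d m₂ (weightCLM W hW (e i)) x)‖ₑ ^ 2 ≤
        2 * ((t : ℝ≥0∞) ^ 2 * ‖∑ n ∈ (finite_nearSet hfin hτ k).toFinset,
          character n x • matCLM (W n) (e i n)‖ₑ ^ 2) +
        2 * ∑' k : ℤ, ((2 ^ k : ℝ≥0) : ℝ≥0∞) ^ 2 *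
          ‖discreteFourier d m₂ (Tf k (e i)) x‖ₑ ^ 2 := by
      intro i
      rw [hx i k]
      generalize (∑ n ∈ (finite_nearSet hfin hτ k).toFinset,
          character n x • matCLM (W n) (e i n)) = a
      have hfar := ENNReal.le_tsum (f := fun k : ℤ => ((2 ^ k : ℝ≥0) : ℝ≥0∞) ^ 2 *
          ‖discreteFourier d m₂ (Tf k (e i)) x‖ₑ ^ 2) k
      refine le_trans ?_ (add_le_add_right (mul_le_mul_right hfar 2) _)
      generalize discreteFourier d m₂ (Tf k (e i)) x = b
      calc ‖matCLM (f x) (a + b)‖ₑ ^ 2 ≤ (t * (‖a‖ₑ + ‖b‖ₑ)) ^ 2 := by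
            gcongr
            refine (enorm_matCLM_apply_le _ _).trans ?_
            gcongr
            exact enorm_add_le a b
        _ = (t : ℝ≥0∞) ^ 2 * (‖a‖ₑ + ‖b‖ₑ) ^ 2 := mul_pow _ _ _
        _ ≤ (t : ℝ≥0∞) ^ 2 * (2 * (‖a‖ₑ ^ 2 + ‖b‖ₑ ^ 2)) := by
            gcongr
            have := ENNReal.rpow_add_le_mul_rpow_add_rpow ‖a‖ₑ ‖b‖ₑ (p := 2) (by norm_num)
            norm_num at this
            exact this
        _ = 2 * ((t : ℝ≥0∞) ^ 2 * ‖a‖ₑ ^ 2) + 2 * ((t : ℝ≥0∞) ^ 2 * ‖b‖ₑ ^ 2) := by ring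
        _ ≤ _ := by gcongr
    refine (Finset.sum_le_sum fun i _ => hi i).trans ?_
    rw [Finset.sum_add_distrib, ← Finset.mul_sum, ← Finset.mul_sum, ← Finset.mul_sum]
    refine (add_le_add (mul_le_mul_right
      (sum_enorm_near_le (finite_nearSet hfin hτ k) hk1 hM hS x) 2) le_rfl).trans_eq ?_
    rw [← mul_assoc 2]
  rw [← lintegral_finsetSum']
  · refine (lintegral_mono_ae hbound).trans ?_
    rw [lintegral_add_right', lintegral_const_mul' _ _ (by finiteness),
      lintegral_const_mul' _ _ (by finiteness)]
    · refine add_le_add le_rfl ?_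
      rw [lintegral_finsetSum', Finset.mul_sum, Finset.mul_sum]
      · refine Finset.sum_le_sum fun i _ => ?_
        rw [lintegral_tsum fun k => (hfar_meas i k).const_mul _]
        simp_rw [lintegral_const_mul' _ _ (ENNReal.pow_ne_top ENNReal.coe_ne_top),
          lintegral_enorm_sq_eq]
        have h5 : ∀ k, ‖discreteFourier d m₂ (Tf k (e i))‖ₑ = ‖Tf k (e i)‖ₑ := fun k => by
          simp only [enorm_eq_nnnorm, LinearIsometry.nnnorm_map]
        simp_rw [h5]
        refine (mul_le_mul_right (tsum_far_le hW τ (e i)) 2).trans_eq ?_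
        ring
      · exact fun i _ => AEMeasurable.tsum fun k => (hfar_meas i k).const_mul _
    · exact (Finset.aemeasurable_fun_sum _ fun i _ =>
        AEMeasurable.tsum fun k => (hfar_meas i k).const_mul _).const_mul _
  · exact fun i _ =>
      (aestronglyMeasurable_matCLM_apply hf (Lp.aestronglyMeasurable _)).enorm.pow_const 2

end Energy

/-! ### The operator, its compactness and its singular numbers -/

/-- An operator which is small on sequences vanishing on a large finite set is compact, being the
norm limit of its compositions with the projections onto finitely many coordinates. -/
theorem isCompactOperator_of_small_off_finset {d m : ℕ} {H : Type*} [NormedAddCommGroup H]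
    [NormedSpace ℂ H] [CompleteSpace H] (A : SeqSpace d m →L[ℂ] H)
    (h : ∀ ε : ℝ, 0 < ε → ∃ F : Finset (Fin d → ℤ), ∀ u : SeqSpace d m, (∀ n ∈ F, u n = 0) →
      ‖A u‖ ≤ ε * ‖u‖) : IsCompactOperator A := by
  classical
  have hcl : A ∈ closure {B : SeqSpace d m →L[ℂ] H | IsCompactOperator B} := by
    rw [Metric.mem_closure_iff]
    intro ε hε
    obtain ⟨F, hF⟩ := h (ε / 2) (by positivity)
    let E := fun _ : Fin d → ℤ => EuclideanSpace ℂ (Fin m)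
    let P : SeqSpace d m →L[ℂ] SeqSpace d m :=
      ∑ n ∈ F, lp.singleContinuousLinearMap ℂ E 2 n ∘L lp.evalCLM ℂ E 2 n
    have hP : ∀ u, P u = ∑ n ∈ F, lp.single 2 n (u n) := fun u => by
      simp only [P, sum_apply]; rfl
    refine ⟨A ∘L P, ?_, ?_⟩
    · have h1 : A ∘L P = ∑ n ∈ F, (A ∘L lp.singleContinuousLinearMap ℂ E 2 n) ∘L
          lp.evalCLM ℂ E 2 n := by
        ext u
        simp [P, sum_apply]
      have h2 : ∀ G : Finset (Fin d → ℤ), IsCompactOperator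
          (∑ n ∈ G, (A ∘L lp.singleContinuousLinearMap ℂ E 2 n) ∘L lp.evalCLM ℂ E 2 n :
            SeqSpace d m →L[ℂ] H) := by
        intro G
        induction G using Finset.induction_on with
        | empty => simpa using isCompactOperator_zero
        | insert n G hn ih =>
          rw [Finset.sum_insert hn]
          refine IsCompactOperator.add ?_ ih
          exact (isCompactOperator_of_locallyCompactSpace_dom (lp.evalCLM ℂ E 2 n)).clm_comp
            (A ∘L lp.singleContinuousLinearMap ℂ E 2 n)
      rw [Set.mem_ofPred_eq, h1]
      exact h2 F
    · rw [dist_eq_norm]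
      refine lt_of_le_of_lt (ContinuousLinearMap.opNorm_le_bound _ (by positivity) fun u => ?_)
        (half_lt_self hε)
      have h3 : (A - A ∘L P) u = A (u - P u) := by simp
      have h4 : ‖u - P u‖ ≤ ‖u‖ := by
        have h5 := lp.norm_sub_norm_compl_sub_single (p := 2) (by simp) u F
        rw [← hP] at h5
        simp only [ENNReal.toReal_ofNat, Real.rpow_ofNat] at h5
        have h6 : (0 : ℝ) ≤ ∑ n ∈ F, ‖u n‖ ^ 2 := by positivity
        exact le_of_sq_le_sq (by linarith) (norm_nonneg _)
      rw [h3]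
      refine (hF _ fun n hn => ?_).trans (by gcongr)
      rw [hP]
      have h7 : (∑ k ∈ F, lp.single 2 k (u k) : SeqSpace d m) n = u n := by
        rw [lp.coeFn_sum, Finset.sum_apply, Finset.sum_eq_single n]
        · simp
        · intro k _ hkn
          rw [lp.coeFn_single, Pi.single_eq_of_ne' hkn]
        · exact fun h => absurd hn h
      rw [lp.coeFn_sub, Pi.sub_apply, h7, sub_self]
  rwa [isClosed_setOfPred_isCompactOperator.closure_eq] at hcl

section Operator

variable {d m₁ m₂ m₃ : ℕ} {f : (Fin d → ℝ) → Matrix (Fin m₁) (Fin m₂) ℂ}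
  {W : (Fin d → ℤ) → Matrix (Fin m₂) (Fin m₃) ℂ}

/-- The energy estimate for a single vector. -/
theorem lintegral_le_of_vanishing
    (hf : ∀ i j, AEStronglyMeasurable (fun x => f x i j) (torusMeasure d))
    (hW : BddAbove (Set.range fun n => entrySum (W n)))
    (hfin : ∀ ε : ℝ≥0, 0 < ε → {n | ε < entrySum (W n)}.Finite) {τ : ℝ≥0} (hτ : 0 < τ)
    {S : Set (Fin d → ℤ)} (u : SeqSpace d m₃) (hu : ∀ n ∈ S, u n = 0) :
    ∫⁻ x, ‖matCLM (f x) (discreteFourier d m₂ (weightCLM W hW u) x)‖ₑ ^ 2 ∂(torusMeasure d) ≤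
      (2 * m₂ * overlapEnergy f W τ S + 4 * (τ : ℝ≥0∞) ^ 2) * ‖u‖ₑ ^ 2 := by
  have h := sum_lintegral_le hf hW hfin hτ (fun _ : Unit => u) (M := ‖u‖₊ ^ 2) (S := S)
    (fun y => by
      have := norm_inner_le_norm (𝕜 := ℂ) y u
      simp only [Finset.univ_unique, Finset.sum_const, Finset.card_singleton, one_smul]
      push_cast
      rw [← mul_pow]
      gcongr
      rwa [mul_comm])
    (fun _ => hu)
  simp only [Finset.univ_unique, Finset.sum_const, Finset.card_singleton, one_smul] at h
  refine h.trans_eq ?_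
  rw [enorm_eq_nnnorm]
  push_cast
  ring

theorem eLpNorm_two_sq {X E : Type*} [MeasurableSpace X] {μ : Measure X} [NormedAddCommGroup E]
    (g : X → E) : eLpNorm g 2 μ ^ 2 = ∫⁻ x, ‖g x‖ₑ ^ 2 ∂μ := by
  have h := eLpNorm_nnreal_pow_eq_lintegral (f := g) (μ := μ) (p := 2) two_ne_zero
  simpa using h

/-- The operator `f Φ W`. For unbounded `f` it is the energy estimate that makes the pointwise
product `f (Φ W u)` square integrable. -/
theorem exists_clm_of_overlapEnergy_ne_top
    (hf : ∀ i j, AEStronglyMeasurable (fun x => f x i j) (torusMeasure d))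
    (hW : BddAbove (Set.range fun n => entrySum (W n)))
    (hfin : ∀ ε : ℝ≥0, 0 < ε → {n | ε < entrySum (W n)}.Finite)
    (hE : overlapEnergy f W 1 ∅ ≠ ∞) :
    ∃ A : SeqSpace d m₃ →L[ℂ] FunSpace d m₁, ∀ u, ∀ᵐ x ∂(torusMeasure d),
      A u x = matCLM (f x) (discreteFourier d m₂ (weightCLM W hW u) x) := by
  set K : ℝ≥0∞ := 2 * m₂ * overlapEnergy f W 1 ∅ + 4 * ((1 : ℝ≥0) : ℝ≥0∞) ^ 2
  have hK : K ≠ ∞ := by finiteness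
  have hle : ∀ u, ∫⁻ x, ‖matCLM (f x) (discreteFourier d m₂ (weightCLM W hW u) x)‖ₑ ^ 2
      ∂(torusMeasure d) ≤ K * ‖u‖ₑ ^ 2 := fun u =>
    lintegral_le_of_vanishing hf hW hfin one_pos u (fun n hn => absurd hn (Set.notMem_empty n))
  have hmem : ∀ u, MemLp (fun x => matCLM (f x) (discreteFourier d m₂ (weightCLM W hW u) x)) 2
      (torusMeasure d) := fun u => by
    refine ⟨aestronglyMeasurable_matCLM_apply hf (Lp.aestronglyMeasurable _), ?_⟩
    have h1 : eLpNorm (fun x => matCLM (f x) (discreteFourier d m₂ (weightCLM W hW u) x)) 2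
      (torusMeasure d) ^ 2 ≠ ∞ := by
      rw [eLpNorm_two_sq]
      exact ne_top_of_le_ne_top (by finiteness) (hle u)
    rw [lt_top_iff_ne_top]
    rintro h2
    simp [h2] at h1
  let A₀ : SeqSpace d m₃ →ₗ[ℂ] FunSpace d m₁ :=
    { toFun := fun u => (hmem u).toLp
      map_add' := fun u v => by
        rw [← MemLp.toLp_add]
        refine MemLp.toLp_congr _ _ ?_
        rw [map_add, map_add]
        filter_upwards [Lp.coeFn_add (discreteFourier d m₂ (weightCLM W hW u))
          (discreteFourier d m₂ (weightCLM W hW v))] with x hx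
        rw [hx, Pi.add_apply, Pi.add_apply, map_add]
      map_smul' := fun c u => by
        rw [RingHom.id_apply, ← MemLp.toLp_const_smul]
        refine MemLp.toLp_congr _ _ ?_
        rw [map_smul, map_smul]
        filter_upwards [Lp.coeFn_smul c (discreteFourier d m₂ (weightCLM W hW u))] with x hx
        rw [hx, Pi.smul_apply, Pi.smul_apply, map_smul] }
  refine ⟨A₀.mkContinuous (√K.toReal) fun u => ?_, fun u => (hmem u).coeFn_toLp⟩
  have h2 : ‖A₀ u‖ₑ ^ 2 ≤ K * ‖u‖ₑ ^ 2 := by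
    refine le_trans (le_of_eq ?_) (hle u)
    rw [← eLpNorm_two_sq]
    exact congrArg (· ^ 2) (Lp.enorm_toLp (hf := hmem u))
  have h3 := ENNReal.toReal_mono (by finiteness) h2
  simp only [ENNReal.toReal_mul, ENNReal.toReal_pow, toReal_enorm] at h3
  refine le_of_sq_le_sq ?_ (by positivity)
  rwa [mul_pow, Real.sq_sqrt ENNReal.toReal_nonneg]

theorem overlapEnergy_eq_tsum
    (hf : ∀ i j, AEStronglyMeasurable (fun x => f x i j) (torusMeasure d)) (τ : ℝ≥0)
    (S : Set (Fin d → ℤ)) :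
    overlapEnergy f W τ S = ∑' n, Sᶜ.indicator (fun n => ∫⁻ x, gain τ (entrySum (f x))
      (entrySum (W n)) ∂(torusMeasure d)) n := by
  classical
  unfold overlapEnergy
  rw [lintegral_tsum]
  · refine tsum_congr fun n => ?_
    by_cases hn : n ∈ Sᶜ <;> simp [hn]
  · intro n
    by_cases hn : n ∈ Sᶜ
    · simp only [Set.indicator_of_mem hn]
      exact (measurable_gain τ (entrySum (W n))).comp_aemeasurable (aemeasurable_entrySum hf)
    · simp [hn]

theorem exists_finset_overlapEnergy_lt
    (hf : ∀ i j, AEStronglyMeasurable (fun x => f x i j) (torusMeasure d)) {τ : ℝ≥0}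
    (hE : overlapEnergy f W τ ∅ ≠ ∞) {ε : ℝ≥0∞} (hε : 0 < ε) :
    ∃ F : Finset (Fin d → ℤ), overlapEnergy f W τ F < ε := by
  rw [overlapEnergy_eq_tsum hf, Set.compl_empty, Set.indicator_univ] at hE
  obtain ⟨F, hF⟩ := ((ENNReal.tendsto_tsum_compl_atTop_zero hE).eventually_lt_const hε).exists
  refine ⟨F, ?_⟩
  rw [overlapEnergy_eq_tsum hf, ← tsum_subtype]
  exact hF

variable {A : SeqSpace d m₃ →L[ℂ] FunSpace d m₁}

theorem enorm_sq_apply_eq {hW : BddAbove (Set.range fun n => entrySum (W n))}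
    (hA : ∀ u, ∀ᵐ x ∂(torusMeasure d),
      A u x = matCLM (f x) (discreteFourier d m₂ (weightCLM W hW u) x)) (u : SeqSpace d m₃) :
    ‖A u‖ₑ ^ 2 = ∫⁻ x, ‖matCLM (f x) (discreteFourier d m₂ (weightCLM W hW u) x)‖ₑ ^ 2
      ∂(torusMeasure d) := by
  rw [← lintegral_enorm_sq_eq]
  refine lintegral_congr_ae ?_
  filter_upwards [hA u] with x hx
  rw [hx]

/-- For fixed `τ` the overlap energy off a large finite set is small, so `f Φ W` has norm of order
`τ` on sequences vanishing there. -/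
theorem isCompactOperator_of_overlapEnergy_ne_top
    (hf : ∀ i j, AEStronglyMeasurable (fun x => f x i j) (torusMeasure d))
    {hW : BddAbove (Set.range fun n => entrySum (W n))}
    (hfin : ∀ ε : ℝ≥0, 0 < ε → {n | ε < entrySum (W n)}.Finite)
    (hE : ∀ τ : ℝ≥0, 0 < τ → overlapEnergy f W τ ∅ ≠ ∞)
    (hA : ∀ u, ∀ᵐ x ∂(torusMeasure d),
      A u x = matCLM (f x) (discreteFourier d m₂ (weightCLM W hW u) x)) :
    IsCompactOperator A := by
  refine isCompactOperator_of_small_off_finset A fun ε hε => ?_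
  lift ε to ℝ≥0 using hε.le
  have hε' : (0 : ℝ≥0) < ε := by exact_mod_cast hε
  obtain ⟨F, hF⟩ := exists_finset_overlapEnergy_lt (ε := ((ε ^ 2 / (4 * (m₂ + 1)) : ℝ≥0) : ℝ≥0∞)) hf
    (hE (ε / 4) (by positivity)) (by exact_mod_cast (by positivity))
  refine ⟨F, fun u hu => ?_⟩
  have h1 := lintegral_le_of_vanishing hf hW hfin (τ := ε / 4) (by positivity) (S := F) u
    (fun n hn => hu n hn)
  rw [← enorm_sq_apply_eq hA] at h1
  have h2 : 2 * (m₂ : ℝ≥0∞) * overlapEnergy f W (ε / 4) F + 4 * ((ε / 4 : ℝ≥0) : ℝ≥0∞) ^ 2 ≤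
      ((ε ^ 2 : ℝ≥0) : ℝ≥0∞) := by
    calc _ ≤ 2 * (m₂ : ℝ≥0∞) * ((ε ^ 2 / (4 * (m₂ + 1)) : ℝ≥0) : ℝ≥0∞) +
          4 * ((ε / 4 : ℝ≥0) : ℝ≥0∞) ^ 2 := by gcongr
      _ = ((2 * m₂ * (ε ^ 2 / (4 * (m₂ + 1))) + 4 * (ε / 4) ^ 2 : ℝ≥0) : ℝ≥0∞) := by push_cast; rfl
      _ ≤ _ := by
        rw [ENNReal.coe_le_coe, ← NNReal.coe_le_coe]
        push_cast
        have h3 : (2 * m₂ * (ε ^ 2 / (4 * (m₂ + 1))) : ℝ) ≤ ε ^ 2 / 2 := by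
          rw [mul_div_assoc', div_le_iff₀ (by positivity)]
          nlinarith [sq_nonneg (ε : ℝ)]
        nlinarith [sq_nonneg (ε : ℝ)]
  have h4 : ‖A u‖ₑ ^ 2 ≤ ((ε ^ 2 : ℝ≥0) : ℝ≥0∞) * ‖u‖ₑ ^ 2 := h1.trans (by gcongr)
  simp only [enorm_eq_nnnorm] at h4
  have h5 : ‖A u‖₊ ^ 2 ≤ ε ^ 2 * ‖u‖₊ ^ 2 := by exact_mod_cast h4
  rw [← mul_pow] at h5
  have h6 : ‖A u‖₊ ≤ ε * ‖u‖₊ := (pow_le_pow_iff_left₀ zero_le zero_le two_ne_zero).mp h5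
  exact h6

/-- Discarding the coordinates in `S` costs at most `m₃ |S|` singular numbers. On an orthonormal
system of eigenvectors vanishing on `S` the energy estimate with a threshold `τ` proportional to
`s` leaves only the overlap energy to be compared with `s²` times the size of the system. -/
theorem singularCount_le_overlapEnergy
    (hf : ∀ i j, AEStronglyMeasurable (fun x => f x i j) (torusMeasure d))
    {hW : BddAbove (Set.range fun n => entrySum (W n))}
    (hfin : ∀ ε : ℝ≥0, 0 < ε → {n | ε < entrySum (W n)}.Finite)
    (hA : ∀ u, ∀ᵐ x ∂(torusMeasure d),
      A u x = matCLM (f x) (discreteFourier d m₂ (weightCLM W hW u) x))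
    {s : ℝ≥0} (hs : 0 < s) (S : Finset (Fin d → ℤ)) :
    (singularCount s A : ℝ≥0∞) ≤
      m₃ * S.card + 4 * m₂ * overlapEnergy f W (s / 4) S / (s : ℝ≥0∞) ^ 2 := by
  let L : SeqSpace d m₃ →ₗ[ℂ] (S → EuclideanSpace ℂ (Fin m₃)) :=
    LinearMap.pi fun n => lp.evalₗ (fun _ => EuclideanSpace ℂ (Fin m₃)) 2 (n : Fin d → ℤ)
  have hrank : (Module.finrank ℂ (S → EuclideanSpace ℂ (Fin m₃)) : ℝ≥0∞) = m₃ * S.card := by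
    rw [Module.finrank_pi_fintype]
    simp [mul_comm]
  rw [← hrank]
  refine singularCount_le_of_orthonormal A L s.coe_nonneg fun M e he heL hle => ?_
  -- With `τ = s / 4` the far part costs at most `s² / 4` for each vector of the system.
  have h1 := sum_lintegral_le hf hW hfin (τ := s / 4) (by positivity) e (M := 1) (S := S)
    (fun y => by
      have := he.sum_inner_products_le y (s := Finset.univ)
      simp_rw [norm_inner_symm y]
      simpa using this)
    (fun i n hn => congrFun (heL i) ⟨n, hn⟩)
  simp_rw [← enorm_sq_apply_eq hA] at h1
  have h2 : ∀ i, ‖e i‖ₑ = 1 := fun i => by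
    rw [← ofReal_norm, he.1 i, ENNReal.ofReal_one]
  have h3 : ∀ i, (s : ℝ≥0∞) ^ 2 ≤ ‖A (e i)‖ₑ ^ 2 := fun i => by
    gcongr
    rw [enorm_eq_nnnorm]
    exact ENNReal.coe_le_coe.mpr (hle i)
  have h4 := (Finset.sum_le_sum fun i (_ : i ∈ Finset.univ) => h3 i).trans h1
  simp only [h2, one_pow, Finset.sum_const, Finset.card_univ, Fintype.card_fin, nsmul_eq_mul,
    mul_one, ENNReal.coe_one] at h4
  rw [ENNReal.le_div_iff_mul_le (Or.inl (by positivity)) (Or.inl (by finiteness))]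
  rcases eq_or_ne (overlapEnergy f W (s / 4) S) ∞ with hE | hE
  · rcases Nat.eq_zero_or_pos m₂ with hm | hm
    · subst hm
      have h5 : M = 0 := by
        by_contra hM
        rw [Nat.cast_zero, mul_zero, zero_mul, zero_add] at h4
        have h6 : (M : ℝ≥0) * s ^ 2 ≤ 4 * (s / 4) ^ 2 * M := by exact_mod_cast h4
        have h7 : (M : ℝ) * s ^ 2 ≤ 4 * (s / 4) ^ 2 * M := by exact_mod_cast h6
        have h8 : (0 : ℝ) < M * s ^ 2 := by positivity
        nlinarith
      simp [h5]
    · rw [hE, ENNReal.mul_top (by positivity)]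
      exact le_top
  · lift overlapEnergy f W (s / 4) S to ℝ≥0 using hE with E
    have h6 : (M : ℝ≥0) * s ^ 2 ≤ 2 * m₂ * E + 4 * (s / 4) ^ 2 * M := by exact_mod_cast h4
    have h7 : (M : ℝ) * s ^ 2 ≤ 2 * m₂ * E + 4 * (s / 4) ^ 2 * M := by exact_mod_cast h6
    have h8 : (M : ℝ) * s ^ 2 ≤ 4 * m₂ * E := by
      have : (0 : ℝ) ≤ M * s ^ 2 := by positivity
      have : (0 : ℝ) ≤ m₂ * E := by positivity
      nlinarith
    exact_mod_cast h8

end Operator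

/-! ### Weak-type sums -/

section WeakSums

/-- The weak-type bound `#{n : s < ν n} ≤ (b / s) ^ p` for all `s > 0`. -/
def WeakBound {I : Type*} (ν : I → ℝ≥0) (b : ℝ≥0) (p : ℝ) : Prop :=
  ∀ s : ℝ≥0, 0 < s → ({n | s < ν n}.encard : ℝ≥0∞) ≤ ((b / s) ^ p : ℝ≥0)

variable {I : Type*} {ν : I → ℝ≥0} {b : ℝ≥0} {p : ℝ}

/-- A sum over `n` is compared with one over scales: at scale `j` every `n` with `ν n > a j`
is allowed to contribute `c j`. -/
theorem tsum_le_tsum_scales (hb : WeakBound ν b p) {g : I → ℝ≥0∞} {a c : ℕ → ℝ≥0}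
    (ha : ∀ j, 0 < a j) (hg : ∀ n, g n ≠ 0 → ∃ j, a j < ν n ∧ g n ≤ c j) :
    ∑' n, g n ≤ ∑' j, ((c j * (b / a j) ^ p : ℝ≥0) : ℝ≥0∞) := by
  calc ∑' n, g n ≤ ∑' n, ∑' j, {n | a j < ν n}.indicator (fun _ => (c j : ℝ≥0∞)) n := by
        refine ENNReal.tsum_le_tsum fun n => ?_
        rcases eq_or_ne (g n) 0 with h0 | h0
        · simp [h0]
        obtain ⟨j, hj, hle⟩ := hg n h0
        refine le_trans ?_ (ENNReal.le_tsum j)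
        have : n ∈ {n | a j < ν n} := hj
        rwa [Set.indicator_of_mem this]
    _ = ∑' j, ∑' n, {n | a j < ν n}.indicator (fun _ => (c j : ℝ≥0∞)) n := ENNReal.tsum_comm
    _ ≤ _ := by
        refine ENNReal.tsum_le_tsum fun j => ?_
        rw [← tsum_subtype, ENNReal.tsum_set_const, mul_comm, ENNReal.coe_mul]
        gcongr
        exact hb _ (ha j)

/-- The sum over dyadic scales `x₀ qʲ` of `σ`-th powers against a weak-type bound: a geometric
series of ratio `q ^ (σ - p)`. -/
theorem tsum_scales_eq {x₀ q : ℝ≥0} (hx : 0 < x₀) (hq : 0 < q) {σ : ℝ} (hρ : q ^ (σ - p) < 1) :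
    ∑' j : ℕ, (((x₀ * q ^ j) ^ σ * (b / (x₀ * q ^ j / 2)) ^ p : ℝ≥0) : ℝ≥0∞) =
      ((2 ^ p * (1 - q ^ (σ - p))⁻¹ * (b ^ p * x₀ ^ (σ - p)) : ℝ≥0) : ℝ≥0∞) := by
  have hterm : ∀ j : ℕ, (x₀ * q ^ j) ^ σ * (b / (x₀ * q ^ j / 2)) ^ p =
      2 ^ p * (b ^ p * x₀ ^ (σ - p)) * (q ^ (σ - p)) ^ j := by
    intro j
    have hy : x₀ * q ^ j ≠ 0 := by positivity
    have h1 : (b / (x₀ * q ^ j / 2)) ^ p = 2 ^ p * b ^ p / (x₀ * q ^ j) ^ p := by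
      rw [← NNReal.mul_rpow, ← NNReal.div_rpow]
      congr 1
      field_simp
    have h2 : (x₀ * q ^ j) ^ (σ - p) = x₀ ^ (σ - p) * (q ^ (σ - p)) ^ j := by
      rw [NNReal.mul_rpow, ← NNReal.rpow_natCast q, ← NNReal.rpow_natCast (q ^ (σ - p)),
        ← NNReal.rpow_mul, ← NNReal.rpow_mul, mul_comm (j : ℝ)]
    rw [h1]
    calc _ = 2 ^ p * b ^ p * ((x₀ * q ^ j) ^ σ / (x₀ * q ^ j) ^ p) := by ring
      _ = _ := by rw [← NNReal.rpow_sub hy, h2]; ring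
  simp_rw [hterm, ENNReal.coe_mul _ ((q ^ (σ - p)) ^ _), ENNReal.coe_pow]
  rw [ENNReal.tsum_mul_left, ENNReal.tsum_geometric, ← ENNReal.coe_one, ← ENNReal.coe_sub,
    ← ENNReal.coe_inv (tsub_pos_of_lt hρ).ne', ← ENNReal.coe_mul]
  congr 1
  ring

theorem tsum_rpow_le_of_le (hb : WeakBound ν b p) {r : ℝ} (hr0 : 0 < r) (hpr : p < r) {l : ℝ≥0}
    (hl : 0 < l) :
    ∑' n, (if ν n ≤ l then ((ν n ^ r : ℝ≥0) : ℝ≥0∞) else 0) ≤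
      ((2 ^ p * (1 - 2⁻¹ ^ (r - p))⁻¹ * (b ^ p * l ^ (r - p)) : ℝ≥0) : ℝ≥0∞) := by
  have h2 : (2⁻¹ : ℝ≥0) < 1 := by rw [inv_lt_one₀ two_pos]; exact one_lt_two
  have hρ : (2⁻¹ : ℝ≥0) ^ (r - p) < 1 := NNReal.rpow_lt_one h2 (sub_pos.mpr hpr)
  rw [← tsum_scales_eq hl (by positivity) hρ]
  refine tsum_le_tsum_scales hb (a := fun j => l * 2⁻¹ ^ j / 2) (fun j => by positivity)
    fun n hn => ?_
  have hle : ν n ≤ l := by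
    by_contra hcon
    exact hn (if_neg hcon)
  have hpos : 0 < ν n := by
    rw [pos_iff_ne_zero]
    rintro h0
    simp [h0, hr0.ne'] at hn
  obtain ⟨j, hj1, hj2⟩ := exists_nat_pow_near_of_lt_one (x := ν n / l) (y := 2⁻¹)
    (by positivity) (div_le_one_of_le₀ hle zero_le) (by positivity) h2
  refine ⟨j, ?_, ?_⟩
  · rw [lt_div_iff₀ hl] at hj1
    refine lt_of_eq_of_lt ?_ hj1
    rw [pow_succ, div_eq_mul_inv]
    ring
  · rw [if_pos hle, ENNReal.coe_le_coe]
    rw [div_le_iff₀ hl] at hj2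
    refine NNReal.rpow_le_rpow (hj2.trans_eq (mul_comm _ _)) hr0.le

theorem tsum_sq_le_of_lt (hb : WeakBound ν b p) (hp : 2 < p) {l : ℝ≥0} (hl : 0 < l) :
    ∑' n, (if l < ν n then ((ν n ^ 2 : ℝ≥0) : ℝ≥0∞) else 0) ≤
      ((2 ^ p * (1 - 2 ^ (2 - p))⁻¹ * ((2 * b) ^ p * (2 * l) ^ (2 - p)) : ℝ≥0) : ℝ≥0∞) := by
  have hρ : (2 : ℝ≥0) ^ (2 - p) < 1 :=
    NNReal.rpow_lt_one_of_one_lt_of_neg one_lt_two (by linarith)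
  rw [← tsum_scales_eq (by positivity : 0 < 2 * l) two_pos hρ]
  have h3 : ∀ j : ℕ, 2 * b / (2 * l * 2 ^ j / 2) = b / (l * 2 ^ j / 2) := fun j => by
    field_simp
  simp_rw [h3]
  refine tsum_le_tsum_scales hb (a := fun j => l * 2 ^ j / 2) (fun j => by positivity)
    fun n hn => ?_
  have hlt : l < ν n := by
    by_contra hcon
    exact hn (if_neg hcon)
  obtain ⟨j, hj1, hj2⟩ := exists_nat_pow_near (x := ν n / l) (y := 2)
    ((one_le_div hl).mpr hlt.le) one_lt_two
  refine ⟨j, ?_, ?_⟩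
  · rw [le_div_iff₀ hl, mul_comm] at hj1
    exact (half_lt_self (by positivity)).trans_le hj1
  · rw [if_pos hlt, ENNReal.coe_le_coe, NNReal.rpow_two]
    rw [div_lt_iff₀ hl] at hj2
    refine pow_le_pow_left₀ zero_le (hj2.le.trans_eq ?_) 2
    ring

/-- The sum of squares between two levels. For `p < r` the powers `ν ^ r` are summable below `l`;
for `2 < r = p` the squares are summable above `μ`. -/
theorem exists_tsum_sq_le (p r : ℝ) (h : (p < r ∧ 2 ≤ r) ∨ (2 < p ∧ r = p)) :
    ∃ C : ℝ≥0, ∀ {I : Type} {ν : I → ℝ≥0} {b : ℝ≥0}, WeakBound ν b p →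
      ∀ {μ l : ℝ≥0}, 0 < μ → 0 < l →
        ∑' n, (if μ < ν n ∧ ν n ≤ l then ((ν n ^ 2 : ℝ≥0) : ℝ≥0∞) else 0) ≤
          ((C * (b ^ p * l ^ (r - p) * μ ^ (2 - r)) : ℝ≥0) : ℝ≥0∞) := by
  rcases h with ⟨hpr, hr⟩ | ⟨hp, rfl⟩
  · refine ⟨2 ^ p * (1 - 2⁻¹ ^ (r - p))⁻¹, fun {I ν b} hb {μ l} hμ hl => ?_⟩
    have h1 := tsum_rpow_le_of_le hb (by linarith) hpr hl
    calc _ ≤ ∑' n, ((μ ^ (2 - r) : ℝ≥0) : ℝ≥0∞) *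
          (if ν n ≤ l then ((ν n ^ r : ℝ≥0) : ℝ≥0∞) else 0) := by
          refine ENNReal.tsum_le_tsum fun n => ?_
          split_ifs with h2 h3
          · rw [← ENNReal.coe_mul, ENNReal.coe_le_coe]
            have hν : 0 < ν n := hμ.trans h2.1
            calc ν n ^ 2 = ν n ^ (2 - r) * ν n ^ r := by
                  rw [← NNReal.rpow_add hν.ne', sub_add_cancel, NNReal.rpow_two]
              _ ≤ μ ^ (2 - r) * ν n ^ r := by
                  exact mul_le_mul_left
                    (NNReal.rpow_le_rpow_of_nonpos hμ h2.1.le (sub_nonpos.mpr hr)) _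
          · exact absurd h2.2 h3
          · exact zero_le
          · exact zero_le
      _ ≤ ((μ ^ (2 - r) : ℝ≥0) : ℝ≥0∞) *
          ((2 ^ p * (1 - 2⁻¹ ^ (r - p))⁻¹ * (b ^ p * l ^ (r - p)) : ℝ≥0) : ℝ≥0∞) := by
          rw [ENNReal.tsum_mul_left]
          gcongr
      _ = _ := by
          rw [← ENNReal.coe_mul]
          congr 1
          ring
  · refine ⟨2 ^ r * (1 - 2 ^ (2 - r))⁻¹ * 2 ^ (2 - r) * 2 ^ r, fun {I ν b} hb {μ l} hμ hl => ?_⟩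
    refine le_trans (ENNReal.tsum_le_tsum fun n => ?_) ((tsum_sq_le_of_lt hb hp hμ).trans_eq ?_)
    · split_ifs with h1 h2
      · exact le_rfl
      · exact absurd h1.1 h2
      · exact zero_le
      · exact zero_le
    · rw [sub_self, NNReal.rpow_zero, NNReal.mul_rpow (x := 2) (y := μ),
        NNReal.mul_rpow (x := 2) (y := b)]
      congr 1
      ring

end WeakSums

/-! ### The overlap energy under a weak-type bound -/

section Overlap

variable {d m₁ m₂ m₃ : ℕ}

/-- The weight `|W|` with the indices in `T` discarded. -/
def offWeight (W : (Fin d → ℤ) → Matrix (Fin m₂) (Fin m₃) ℂ) (T : Set (Fin d → ℤ)) :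
    (Fin d → ℤ) → ℝ≥0 := Tᶜ.indicator fun n => entrySum (W n)

/-- At a point with `|f(x)| = t` only the levels `τ / (2 t) < |W(n)| ≤ l` matter; their sum of
squares times `t²` is a constant multiple of `t ^ r`. -/
theorem exists_overlapEnergy_le (d m₁ m₂ m₃ : ℕ) (p r : ℝ)
    (h : (p < r ∧ 2 ≤ r) ∨ (2 < p ∧ r = p)) :
    ∃ C : ℝ≥0, ∀ (f : (Fin d → ℝ) → Matrix (Fin m₁) (Fin m₂) ℂ)
      (W : (Fin d → ℤ) → Matrix (Fin m₂) (Fin m₃) ℂ) (T : Set (Fin d → ℤ)) {b : ℝ≥0},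
      WeakBound (offWeight W T) b p → ∀ {τ l : ℝ≥0}, 0 < τ → 0 < l →
      overlapEnergy f W τ (T ∪ {n | l < offWeight W T n}) ≤
        ((C * (b ^ p * l ^ (r - p) * τ ^ (2 - r)) : ℝ≥0) : ℝ≥0∞) *
          ∫⁻ x, ((entrySum (f x) ^ r : ℝ≥0) : ℝ≥0∞) ∂(torusMeasure d) := by
  obtain ⟨C, hC⟩ := exists_tsum_sq_le p r h
  refine ⟨C * 2 ^ (r - 2), fun f W T b hb τ l hτ hl => ?_⟩
  rw [← lintegral_const_mul' _ _ ENNReal.coe_ne_top]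
  refine lintegral_mono fun x => ?_
  dsimp only
  set t := entrySum (f x)
  set S : Set (Fin d → ℤ) := T ∪ {n | l < offWeight W T n} with hS
  rcases eq_or_ne t 0 with h0 | h0
  · simp [h0, gain, Set.indicator]
  have ht : 0 < t := pos_iff_ne_zero.mpr h0
  calc ∑' n, Sᶜ.indicator (fun n => gain τ t (entrySum (W n))) n
      ≤ ∑' n, ((t ^ 2 : ℝ≥0) : ℝ≥0∞) *
        (if τ / (2 * t) < offWeight W T n ∧ offWeight W T n ≤ l then
          ((offWeight W T n ^ 2 : ℝ≥0) : ℝ≥0∞) else 0) := by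
        refine ENNReal.tsum_le_tsum fun n => ?_
        by_cases hn : n ∈ Sᶜ
        swap
        · simp [hn]
        have hn1 : n ∈ Tᶜ := fun hT => hn (Or.inl hT)
        have hn2 : offWeight W T n ≤ l := not_lt.mp fun hlt => hn (Or.inr hlt)
        have hn3 : offWeight W T n = entrySum (W n) := Set.indicator_of_mem hn1 _
        rw [Set.indicator_of_mem hn, gain]
        split_ifs with h1 h2 h2
        · rw [hn3, ← ENNReal.coe_pow, ← ENNReal.coe_mul, mul_pow]
        · refine absurd ⟨?_, hn2⟩ h2
          rw [hn3, div_lt_iff₀ (by positivity)]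
          refine h1.trans_eq ?_
          ring
        · exact zero_le
        · exact zero_le
    _ ≤ ((t ^ 2 : ℝ≥0) : ℝ≥0∞) *
        ((C * (b ^ p * l ^ (r - p) * (τ / (2 * t)) ^ (2 - r)) : ℝ≥0) : ℝ≥0∞) := by
        rw [ENNReal.tsum_mul_left]
        gcongr
        exact hC hb (by positivity) hl
    _ = _ := by
        rw [← ENNReal.coe_mul, ← ENNReal.coe_mul]
        congr 1
        have h3 : (τ / (2 * t)) ^ (2 - r) = τ ^ (2 - r) * (2 ^ (r - 2) * t ^ (r - 2)) := by
          rw [NNReal.div_rpow, div_eq_mul_inv, ← NNReal.rpow_neg, neg_sub, NNReal.mul_rpow]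
        have h4 : t ^ 2 * t ^ (r - 2) = t ^ r := by
          rw [← NNReal.rpow_two, ← NNReal.rpow_add h0]
          congr 1
          ring
        rw [h3, ← h4]
        ring

end Overlap

/-! ### The counting estimate -/

section CountBound

variable {d m₁ m₂ m₃ : ℕ}

/-- The central estimate `n(s, f Φ W) ≤ m₃ |T| + C (a b / s) ^ p`, where `a` bounds the `L_r` norm
of `f` and `b` the weak norm of `W` off a finite set `T`. The coordinates in `T` and those with
`|W(n)| > s / a` are discarded at the cost of their number; the rest is the overlap energy. -/
theorem exists_singularCount_le (d m₁ m₂ m₃ : ℕ) (p r : ℝ)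
    (h : (p < r ∧ 2 ≤ r) ∨ (2 < p ∧ r = p)) :
    ∃ C : ℝ≥0, ∀ {f : (Fin d → ℝ) → Matrix (Fin m₁) (Fin m₂) ℂ}
      {W : (Fin d → ℤ) → Matrix (Fin m₂) (Fin m₃) ℂ} {A : SeqSpace d m₃ →L[ℂ] FunSpace d m₁}
      {hW : BddAbove (Set.range fun n => entrySum (W n))},
      (∀ i j, AEStronglyMeasurable (fun x => f x i j) (torusMeasure d)) →
      (∀ ε : ℝ≥0, 0 < ε → {n | ε < entrySum (W n)}.Finite) →
      (∀ u, ∀ᵐ x ∂(torusMeasure d),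
        A u x = matCLM (f x) (discreteFourier d m₂ (weightCLM W hW u) x)) →
      ∀ (T : Finset (Fin d → ℤ)) {a b s : ℝ≥0}, WeakBound (offWeight W T) b p → 0 < a →
      ∫⁻ x, ((entrySum (f x) ^ r : ℝ≥0) : ℝ≥0∞) ∂(torusMeasure d) ≤ ((a ^ r : ℝ≥0) : ℝ≥0∞) →
      0 < s →
      (singularCount s A : ℝ≥0∞) ≤ m₃ * T.card + ((C * (a * b / s) ^ p : ℝ≥0) : ℝ≥0∞) := by
  classical
  obtain ⟨C, hC⟩ := exists_overlapEnergy_le d m₁ m₂ m₃ p r h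
  refine ⟨m₃ + 4 * m₂ * C * (1 / 4) ^ (2 - r),
    fun {f W A hW} hf hfin hA T {a b s} hb ha hfa hs => ?_⟩
  have hl : 0 < s / a := by positivity
  set R : Set (Fin d → ℤ) := {n | s / a < offWeight W T n} with hR
  have hRfin : R.Finite := by
    have : (R.encard : ℝ≥0∞) < ∞ := (hb _ hl).trans_lt ENNReal.coe_lt_top
    rw [← Set.encard_lt_top_iff]
    exact_mod_cast this
  have hRcard : (hRfin.toFinset.card : ℝ≥0∞) ≤ (((a * b / s) ^ p : ℝ≥0) : ℝ≥0∞) := by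
    have h1 := hb _ hl
    rw [← hR, hRfin.encard_eq_coe_toFinset_card] at h1
    have h2 : b / (s / a) = a * b / s := by field_simp
    rw [h2] at h1
    simpa using h1
  have h1 := singularCount_le_overlapEnergy hf hfin hA hs (T ∪ hRfin.toFinset)
  have h2 := hC f W T hb (τ := s / 4) (by positivity) hl
  have hset : ((T ∪ hRfin.toFinset : Finset (Fin d → ℤ)) : Set (Fin d → ℤ)) =
      (T : Set (Fin d → ℤ)) ∪ R := by simp
  rw [hset] at h1
  have h3 : overlapEnergy f W (s / 4) ((T : Set (Fin d → ℤ)) ∪ R) ≤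
      ((C * (1 / 4) ^ (2 - r) * (a * b / s) ^ p * s ^ 2 : ℝ≥0) : ℝ≥0∞) := by
    refine (h2.trans (mul_le_mul_right hfa _)).trans_eq ?_
    rw [← ENNReal.coe_mul]
    congr 1
    have e1 : (s / a) ^ (r - p) = s ^ r / s ^ p * (a ^ p / a ^ r) := by
      rw [NNReal.div_rpow, NNReal.rpow_sub hs.ne', NNReal.rpow_sub ha.ne']
      field_simp
    have e2 : (s / 4) ^ (2 - r) = s ^ 2 / s ^ r * (1 / 4) ^ (2 - r) := by
      rw [← NNReal.rpow_two, ← NNReal.rpow_sub hs.ne', ← NNReal.mul_rpow]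
      congr 1
      ring
    have e3 : (a * b / s) ^ p = a ^ p * b ^ p / s ^ p := by
      rw [NNReal.div_rpow, NNReal.mul_rpow]
    have p1 : 0 < s ^ r := NNReal.rpow_pos hs
    have p2 : 0 < a ^ r := NNReal.rpow_pos ha
    have p3 : 0 < s ^ p := NNReal.rpow_pos hs
    rw [e1, e2, e3]
    field_simp
  calc (singularCount s A : ℝ≥0∞) ≤ _ := h1
    _ ≤ m₃ * (T.card + (((a * b / s) ^ p : ℝ≥0) : ℝ≥0∞)) +
        4 * m₂ * ((C * (1 / 4) ^ (2 - r) * (a * b / s) ^ p * s ^ 2 : ℝ≥0) : ℝ≥0∞) /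
          (s : ℝ≥0∞) ^ 2 := by
        gcongr
        refine le_trans ?_ (add_le_add_right hRcard _)
        exact_mod_cast Finset.card_union_le _ _
    _ = m₃ * T.card + ((m₃ * (a * b / s) ^ p + 4 * m₂ * (C * (1 / 4) ^ (2 - r) *
          (a * b / s) ^ p * s ^ 2) / s ^ 2 : ℝ≥0) : ℝ≥0∞) := by
        rw [ENNReal.coe_add, ENNReal.coe_div (by positivity)]
        push_cast
        ring
    _ = _ := by
        congr 2
        field_simp

theorem WeakBound.apply_le {I : Type*} {ν : I → ℝ≥0} {b : ℝ≥0} {p : ℝ} (hp : 0 < p)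
    (hb : WeakBound ν b p) (n : I) : ν n ≤ b := by
  by_contra hcon
  obtain ⟨s, hs1, hs2⟩ := exists_between (not_le.mp hcon)
  have hs : 0 < s := pos_of_gt hs1
  have h1 : (b / s) ^ p < 1 := NNReal.rpow_lt_one ((div_lt_one hs).mpr hs1) hp
  have h2 : (1 : ℕ∞) ≤ {n | s < ν n}.encard := Set.one_le_encard_iff_nonempty.mpr ⟨n, hs2⟩
  have h3 : ((1 : ℕ∞) : ℝ≥0∞) ≤ ((b / s) ^ p : ℝ≥0) :=
    (ENat.toENNReal_le.mpr h2).trans (hb s hs)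
  have h4 : ((1 : ℝ≥0) : ℝ≥0∞) ≤ ((b / s) ^ p : ℝ≥0) := by simpa using h3
  exact absurd (ENNReal.coe_le_coe.mp h4) (not_le.mpr h1)

theorem WeakBound.finite {I : Type*} {ν : I → ℝ≥0} {b : ℝ≥0} {p : ℝ} (hb : WeakBound ν b p)
    {s : ℝ≥0} (hs : 0 < s) : {n | s < ν n}.Finite := by
  rw [← Set.encard_lt_top_iff]
  exact_mod_cast (hb s hs).trans_lt ENNReal.coe_lt_top

theorem offWeight_empty (W : (Fin d → ℤ) → Matrix (Fin m₂) (Fin m₃) ℂ) :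
    offWeight W ∅ = fun n => entrySum (W n) := by
  simp [offWeight]

/-- The cut at the level `l = b + 1` is void, since a weight with weak norm `b` on a discrete set is
bounded by `b`. -/
theorem overlapEnergy_ne_top {p r : ℝ} (hp : 0 < p) (h : (p < r ∧ 2 ≤ r) ∨ (2 < p ∧ r = p))
    {f : (Fin d → ℝ) → Matrix (Fin m₁) (Fin m₂) ℂ} {W : (Fin d → ℤ) → Matrix (Fin m₂) (Fin m₃) ℂ}
    {b : ℝ≥0} (hb : WeakBound (fun n => entrySum (W n)) b p)
    (hfr : ∫⁻ x, ((entrySum (f x) ^ r : ℝ≥0) : ℝ≥0∞) ∂(torusMeasure d) ≠ ∞) {τ : ℝ≥0}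
    (hτ : 0 < τ) : overlapEnergy f W τ ∅ ≠ ∞ := by
  obtain ⟨C, hC⟩ := exists_overlapEnergy_le d m₁ m₂ m₃ p r h
  have hb' := hb
  rw [← offWeight_empty] at hb'
  have h1 := hC f W ∅ hb' hτ (l := b + 1) (by positivity)
  have h2 : (∅ ∪ {n | b + 1 < offWeight W ∅ n} : Set (Fin d → ℤ)) = ∅ := by
    rw [Set.empty_union, Set.eq_empty_iff_forall_notMem]
    intro n hn
    have h3 : b + 1 < offWeight W ∅ n := hn
    exact absurd ((hb'.apply_le hp n).trans (le_add_of_nonneg_right zero_le)) (not_le.mpr h3)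
  rw [h2] at h1
  exact ne_top_of_le_ne_top (ENNReal.mul_ne_top ENNReal.coe_ne_top hfr) h1

end CountBound

/-! ### From entrywise norms to the weak-type and integral bounds -/

section Norms

variable {d m₁ m₂ m₃ : ℕ}

theorem iSup_iSup_lt_top {m n : ℕ} {g : Fin m → Fin n → ℝ≥0∞} (hg : ∀ i j, g i j < ∞) :
    ⨆ (i) (j), g i j < ∞ := by
  refine lt_of_le_of_lt (iSup₂_le fun i j => ?_)
    (ENNReal.sum_lt_top.mpr fun i (_ : i ∈ Finset.univ) =>
      ENNReal.sum_lt_top.mpr fun j (_ : j ∈ Finset.univ) => hg i j)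
  exact (Finset.single_le_sum_of_canonicallyOrdered (Finset.mem_univ j)).trans
    (Finset.single_le_sum_of_canonicallyOrdered (f := fun i => ∑ j, g i j) (Finset.mem_univ i))

theorem distribution_le_of_weakNorm_le {Z E : Type*} [MeasurableSpace Z] [NormedAddCommGroup E]
    {g : Z → E} {p : ℝ} (hp : 0 < p) {μ : Measure Z} {w : ℝ≥0} (hw : weakNorm g p μ ≤ w)
    {s : ℝ≥0} (hs : 0 < s) : distribution g μ s ≤ ((w / s) ^ p : ℝ≥0) := by
  have h1 : ENNReal.ofReal s * distribution g μ s ^ (1 / p) ≤ w :=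
    (le_iSup₂ (f := fun (s : ℝ) (_ : 0 < s) => ENNReal.ofReal s * distribution g μ s ^ (1 / p))
      (s : ℝ) (NNReal.coe_pos.mpr hs)).trans hw
  rw [ENNReal.ofReal_coe_nnreal] at h1
  have h2 : distribution g μ s ^ (1 / p) ≤ ((w / s : ℝ≥0) : ℝ≥0∞) := by
    rw [ENNReal.coe_div hs.ne', ENNReal.le_div_iff_mul_le (Or.inl (by positivity))
      (Or.inl ENNReal.coe_ne_top), mul_comm]
    exact h1
  rw [one_div, ENNReal.rpow_inv_le_iff hp] at h2
  rwa [ENNReal.coe_rpow_of_nonneg _ hp.le]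

/-- One more than the number of entries; the extra unit keeps it positive for empty matrices. -/
def entryCount (m n : ℕ) : ℝ≥0 := m * n + 1

theorem entryCount_pos (m n : ℕ) : 0 < entryCount m n := by unfold entryCount; positivity

theorem encard_entrySum_le {W : (Fin d → ℤ) → Matrix (Fin m₂) (Fin m₃) ℂ} {s : ℝ≥0} {c : ℝ≥0∞}
    (h : ∀ j k, distribution (fun n => W n j k) Measure.count s ≤ c) :
    ({n | entryCount m₂ m₃ * s < entrySum (W n)}.encard : ℝ≥0∞) ≤ entryCount m₂ m₃ * c := by
  have hsub : {n | entryCount m₂ m₃ * s < entrySum (W n)} ⊆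
      ⋃ j, ⋃ k, {n | (s : ℝ) < ‖W n j k‖} := by
    intro n hn
    by_contra hcon
    simp only [Set.mem_iUnion, not_exists] at hcon
    have h1 : entrySum (W n) ≤ ∑ _j : Fin m₂, ∑ _k : Fin m₃, s :=
      Finset.sum_le_sum fun j _ => Finset.sum_le_sum fun k _ => not_lt.mp (hcon j k)
    have h2 : ∑ _j : Fin m₂, ∑ _k : Fin m₃, s ≤ entryCount m₂ m₃ * s := by
      simp only [Finset.sum_const, Finset.card_univ, Fintype.card_fin, nsmul_eq_mul, ← mul_assoc]
      gcongr
      exact le_add_of_nonneg_right zero_le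
    exact absurd (h1.trans h2) (not_le.mpr hn)
  rw [← Measure.count_apply (Set.to_countable _).measurableSet]
  calc _ ≤ Measure.count (⋃ j, ⋃ k, {n | (s : ℝ) < ‖W n j k‖}) := measure_mono hsub
    _ ≤ ∑ j, ∑ k, Measure.count {n | (s : ℝ) < ‖W n j k‖} :=
        (measure_iUnion_fintype_le _ _).trans
          (Finset.sum_le_sum fun j _ => measure_iUnion_fintype_le _ _)
    _ ≤ ∑ _j : Fin m₂, ∑ _k : Fin m₃, c :=
        Finset.sum_le_sum fun j _ => Finset.sum_le_sum fun k _ => h j k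
    _ ≤ _ := by
        simp only [Finset.sum_const, Finset.card_univ, Fintype.card_fin, nsmul_eq_mul, ← mul_assoc]
        gcongr
        unfold entryCount
        push_cast
        exact le_add_of_nonneg_right zero_le

theorem weakBound_entrySum {p : ℝ} (hp : 0 < p) {W : (Fin d → ℤ) → Matrix (Fin m₂) (Fin m₃) ℂ}
    {w : ℝ≥0} (hw : matWeakNorm W p Measure.count ≤ w) :
    WeakBound (fun n => entrySum (W n)) (entryCount m₂ m₃ ^ (1 / p) * entryCount m₂ m₃ * w) p := by
  intro s hs
  have hκ := entryCount_pos m₂ m₃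
  set κ := entryCount m₂ m₃ with hκdef
  have h1 := encard_entrySum_le (W := W) (s := s / κ) (c := (((w / (s / κ)) ^ p : ℝ≥0) : ℝ≥0∞))
    fun j k => distribution_le_of_weakNorm_le hp
      ((le_iSup₂ (f := fun j k => weakNorm (fun n => W n j k) p Measure.count) j k).trans hw)
      (by positivity)
  rw [← hκdef, mul_div_cancel₀ _ hκ.ne'] at h1
  refine h1.trans_eq ?_
  rw [← ENNReal.coe_mul]
  congr 1
  have h2 : κ ^ (1 / p) * κ * w / s = κ ^ (1 / p) * (w / (s / κ)) := by field_simp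
  rw [h2, NNReal.mul_rpow, ← NNReal.rpow_mul, one_div, inv_mul_cancel₀ hp.ne', NNReal.rpow_one]

/-- A weight in the class `ℓ⁰_{p,∞}` has arbitrarily small weak norm off a finite set, namely off
a set `{|W| > δ}`: only levels below `δ` count there. -/
theorem exists_finset_weakBound_offWeight {p : ℝ}
    {W : (Fin d → ℤ) → Matrix (Fin m₂) (Fin m₃) ℂ}
    (hfin : ∀ ε : ℝ≥0, 0 < ε → {n | ε < entrySum (W n)}.Finite)
    (hW : MatMemWeakZero W p Measure.count) {b : ℝ≥0} (hb : 0 < b) :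
    ∃ T : Finset (Fin d → ℤ), WeakBound (offWeight W T) b p := by
  have hκ := entryCount_pos m₂ m₃
  set κ := entryCount m₂ m₃ with hκdef
  set η : ℝ≥0 := (b / κ) ^ p / κ with hη
  have hη0 : 0 < η := div_pos (NNReal.rpow_pos (by positivity)) hκ
  have hev : ∀ᶠ s : ℝ in 𝓝[>] 0, ∀ j k,
      ENNReal.ofReal (s ^ p) * distribution (fun n => W n j k) Measure.count s ≤ η := by
    rw [eventually_all]; intro j
    rw [eventually_all]; intro k
    exact (hW j k).2.1.eventually_le_const (by exact_mod_cast hη0)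
  obtain ⟨δ, hδ, hδs⟩ := mem_nhdsGT_iff_exists_Ioo_subset.mp hev
  lift δ to ℝ≥0 using le_of_lt hδ
  have hδ0 : 0 < δ := NNReal.coe_pos.mp hδ
  have hκδ : 0 < κ * (δ / 2) := by positivity
  refine ⟨(hfin _ hκδ).toFinset, fun s hs => ?_⟩
  rw [Set.Finite.coe_toFinset]
  rcases le_or_gt (κ * (δ / 2)) s with hle | hlt
  · have hempty : {n | s < offWeight W {n | κ * (δ / 2) < entrySum (W n)} n} = ∅ := by
      rw [Set.eq_empty_iff_forall_notMem]
      intro n hn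
      have hn' : s < offWeight W {n | κ * (δ / 2) < entrySum (W n)} n := hn
      unfold offWeight at hn'
      by_cases h1 : n ∈ {n | κ * (δ / 2) < entrySum (W n)}ᶜ
      · rw [Set.indicator_of_mem h1] at hn'
        exact h1 (hle.trans_lt hn')
      · rw [Set.indicator_of_notMem h1] at hn'
        exact not_lt_zero hn'
    simp [hempty]
  · have hsκ : 0 < s / κ := by positivity
    have hsδ : s / κ < δ := by
      rw [div_lt_iff₀ hκ, mul_comm]
      exact hlt.trans_le (by gcongr; exact half_le_self zero_le)
    have h1 : ∀ j k, distribution (fun n => W n j k) Measure.count ((s / κ : ℝ≥0) : ℝ) ≤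
        ((η / (s / κ) ^ p : ℝ≥0) : ℝ≥0∞) := by
      intro j k
      have h2 := hδs (show ((s / κ : ℝ≥0) : ℝ) ∈ Set.Ioo (0 : ℝ) δ from
        ⟨NNReal.coe_pos.mpr hsκ, NNReal.coe_lt_coe.mpr hsδ⟩) j k
      rw [← NNReal.coe_rpow, ENNReal.ofReal_coe_nnreal] at h2
      have h3 : (s / κ) ^ p ≠ 0 := (NNReal.rpow_pos hsκ).ne'
      rw [ENNReal.coe_div h3, ENNReal.le_div_iff_mul_le (Or.inl (by exact_mod_cast h3))
        (Or.inl ENNReal.coe_ne_top), mul_comm]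
      exact h2
    have h4 := encard_entrySum_le h1
    rw [← hκdef, mul_div_cancel₀ _ hκ.ne'] at h4
    have hsub : {n | s < offWeight W {n | κ * (δ / 2) < entrySum (W n)} n} ⊆
        {n | s < entrySum (W n)} := fun n hn => by
      have hn' : s < offWeight W {n | κ * (δ / 2) < entrySum (W n)} n := hn
      exact hn'.trans_le (Set.indicator_le_self _ _ n)
    refine (ENat.toENNReal_le.mpr (Set.encard_le_encard hsub)).trans (h4.trans_eq ?_)
    rw [← ENNReal.coe_mul]
    congr 1
    rw [hη, NNReal.div_rpow, NNReal.div_rpow, NNReal.div_rpow]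
    have p1 : 0 < s ^ p := NNReal.rpow_pos hs
    have p2 : 0 < κ ^ p := NNReal.rpow_pos hκ
    field_simp

theorem exists_lintegral_entrySum_rpow_le (d m₁ m₂ : ℕ) {r : ℝ≥0} (hr : 1 ≤ r) {q : ℝ≥0∞}
    (hrq : (r : ℝ≥0∞) ≤ q) :
    ∃ D : ℝ≥0, ∀ f : (Fin d → ℝ) → Matrix (Fin m₁) (Fin m₂) ℂ, MatMemLp f q (torusMeasure d) →
      ∫⁻ x, ((entrySum (f x) ^ (r : ℝ) : ℝ≥0) : ℝ≥0∞) ∂(torusMeasure d) ≤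
        (D * matLpNorm f q (torusMeasure d)) ^ (r : ℝ) := by
  have hr0 : (0 : ℝ≥0) < r := one_pos.trans_le hr
  set c : ℝ≥0∞ := torusMeasure d Set.univ ^ (1 / (r : ℝ≥0∞).toReal - 1 / q.toReal) with hc
  have hexp : 0 ≤ 1 / (r : ℝ≥0∞).toReal - 1 / q.toReal := by
    rw [sub_nonneg]
    rcases eq_or_ne q ∞ with rfl | hq
    · simp
    · exact one_div_le_one_div_of_le (by simpa using hr0) (ENNReal.toReal_mono hq hrq)
  have hc' : c ≠ ∞ := ENNReal.rpow_ne_top_of_nonneg hexp (measure_ne_top _ _)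
  refine ⟨m₁ * m₂ * c.toNNReal, fun f hf => ?_⟩
  set F := matLpNorm f q (torusMeasure d)
  have h1 : ∫⁻ x, ((entrySum (f x) ^ (r : ℝ) : ℝ≥0) : ℝ≥0∞) ∂(torusMeasure d) =
      eLpNorm (∑ i, ∑ j, fun x => ‖f x i j‖) r (torusMeasure d) ^ (r : ℝ) := by
    rw [eLpNorm_nnreal_pow_eq_lintegral hr0.ne']
    refine lintegral_congr fun x => ?_
    have h2 : ‖(∑ i, ∑ j, fun x => ‖f x i j‖) x‖ₑ = (entrySum (f x) : ℝ≥0∞) := by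
      simp only [Finset.sum_apply]
      rw [Real.enorm_of_nonneg (by positivity), ← ENNReal.ofReal_coe_nnreal]
      simp [entrySum]
    rw [h2, ENNReal.coe_rpow_of_nonneg _ r.coe_nonneg]
  have hr1 : (1 : ℝ≥0∞) ≤ r := by exact_mod_cast hr
  rw [h1]
  refine ENNReal.rpow_le_rpow ?_ r.coe_nonneg
  calc eLpNorm (∑ i, ∑ j, fun x => ‖f x i j‖) r (torusMeasure d)
      ≤ ∑ i, ∑ j, eLpNorm (fun x => ‖f x i j‖) r (torusMeasure d) := by
        refine (eLpNorm_sum_le (fun i _ => ?_) hr1).trans (Finset.sum_le_sum fun i _ =>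
          eLpNorm_sum_le (fun j _ => (hf i j).1.norm) hr1)
        exact Finset.aestronglyMeasurable_sum _ fun j _ => (hf i j).1.norm
    _ ≤ ∑ _i : Fin m₁, ∑ _j : Fin m₂, F * c := by
        refine Finset.sum_le_sum fun i _ => Finset.sum_le_sum fun j _ => ?_
        rw [eLpNorm_norm]
        refine (eLpNorm_le_eLpNorm_mul_rpow_measure_univ hrq (hf i j).1).trans ?_
        gcongr
        exact le_iSup₂ (f := fun i j => eLpNorm (fun z => f z i j) q (torusMeasure d)) i j
    _ = _ := by
        simp only [Finset.sum_const, Finset.card_univ, Fintype.card_fin, nsmul_eq_mul]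
        push_cast
        rw [ENNReal.coe_toNNReal hc']
        ring

end Norms

/-! ### The weak Schatten classes -/

section Schatten

variable {H₁ H₂ : Type*} [NormedAddCommGroup H₁] [InnerProductSpace ℂ H₁] [CompleteSpace H₁]
  [NormedAddCommGroup H₂] [InnerProductSpace ℂ H₂] [CompleteSpace H₂]

theorem schattenWeakNorm_le {p : ℝ} (hp : 0 < p) {A : H₁ →L[ℂ] H₂} {C N : ℝ≥0}
    (h : ∀ s : ℝ≥0, 0 < s → (singularCount s A : ℝ≥0∞) ≤ ((C * (N / s) ^ p : ℝ≥0) : ℝ≥0∞)) :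
    schattenWeakNorm p A ≤ ((C ^ (1 / p) * N : ℝ≥0) : ℝ≥0∞) := by
  refine iSup₂_le fun s hs => ?_
  lift s to ℝ≥0 using hs.le
  have hs' : 0 < s := NNReal.coe_pos.mp hs
  calc _ ≤ ENNReal.ofReal s * ((C * (N / s) ^ p : ℝ≥0) : ℝ≥0∞) ^ (1 / p) := by
        gcongr
        exact h s hs'
    _ = ((s * (C * (N / s) ^ p) ^ (1 / p) : ℝ≥0) : ℝ≥0∞) := by
        rw [ENNReal.ofReal_coe_nnreal, ← ENNReal.coe_rpow_of_nonneg _ (by positivity),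
          ENNReal.coe_mul]
    _ = _ := by
        congr 1
        rw [NNReal.mul_rpow, ← NNReal.rpow_mul, mul_one_div_cancel hp.ne', NNReal.rpow_one]
        field_simp

end Schatten

/-- If `n(s, A)` is bounded by a constant plus an arbitrarily small multiple of `s ^ (-p)`, then it
is `o(s ^ (-p))` as `s → +0`. -/
theorem tendsto_singularCount_of_forall_le {H₁ H₂ : Type*} [NormedAddCommGroup H₁]
    [InnerProductSpace ℂ H₁] [CompleteSpace H₁] [NormedAddCommGroup H₂] [InnerProductSpace ℂ H₂]
    [CompleteSpace H₂] {p : ℝ} (hp : 0 < p) {A : H₁ →L[ℂ] H₂} {C a : ℝ≥0}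
    (h : ∀ b : ℝ≥0, 0 < b → ∃ K : ℝ≥0, ∀ s : ℝ≥0, 0 < s →
      (singularCount s A : ℝ≥0∞) ≤ K + ((C * (a * b / s) ^ p : ℝ≥0) : ℝ≥0∞)) :
    Tendsto (fun s : ℝ => ENNReal.ofReal (s ^ p) * (singularCount s A : ℝ≥0∞)) (𝓝[>] 0) (𝓝 0) := by
  rw [ENNReal.tendsto_nhds_zero]
  intro ε hε
  obtain ⟨η, hη0, hηε⟩ := ENNReal.lt_iff_exists_nnreal_btwn.mp hε
  have hη : 0 < η := by exact_mod_cast hη0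
  obtain ⟨b, hb0, hb⟩ : ∃ b : ℝ≥0, 0 < b ∧ C * (a * b) ^ p < η / 2 := by
    have h1 : Tendsto (fun b : ℝ≥0 => C * (a * b) ^ p) (𝓝[>] 0) (𝓝 0) := by
      have hc : Continuous fun b : ℝ≥0 => C * (a * b) ^ p :=
        continuous_const.mul ((NNReal.continuous_rpow_const hp.le).comp (by fun_prop))
      have := hc.tendsto 0
      simp only [mul_zero, NNReal.zero_rpow hp.ne'] at this
      exact this.mono_left nhdsWithin_le_nhds
    obtain ⟨b, hb1, hb2⟩ := ((h1.eventually_lt_const (half_pos hη)).and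
      self_mem_nhdsWithin).exists
    exact ⟨b, hb2, hb1⟩
  obtain ⟨K, hK⟩ := h b hb0
  have h2 : Tendsto (fun s : ℝ => s ^ p * (K : ℝ)) (𝓝[>] 0) (𝓝 0) := by
    have hc : Continuous fun s : ℝ => s ^ p * (K : ℝ) :=
      (Real.continuous_rpow_const hp.le).mul continuous_const
    have := hc.tendsto 0
    simp only [Real.zero_rpow hp.ne', zero_mul] at this
    exact this.mono_left nhdsWithin_le_nhds
  filter_upwards [h2.eventually_lt_const (NNReal.coe_pos.mpr (half_pos hη)),
    self_mem_nhdsWithin] with s hs1 hs2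
  lift s to ℝ≥0 using le_of_lt hs2
  have hs : 0 < s := NNReal.coe_pos.mp hs2
  rw [← NNReal.coe_rpow, ← NNReal.coe_mul, NNReal.coe_lt_coe] at hs1
  rw [← NNReal.coe_rpow, ENNReal.ofReal_coe_nnreal]
  calc _ ≤ ((s ^ p : ℝ≥0) : ℝ≥0∞) * (K + ((C * (a * b / s) ^ p : ℝ≥0) : ℝ≥0∞)) := by
        gcongr
        exact hK s hs
    _ = ((s ^ p * K + C * (a * b) ^ p : ℝ≥0) : ℝ≥0∞) := by
        rw [← ENNReal.coe_add, ← ENNReal.coe_mul]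
        congr 1
        rw [NNReal.div_rpow]
        have p1 : 0 < s ^ p := NNReal.rpow_pos hs
        field_simp
    _ ≤ (η : ℝ≥0∞) := by
        rw [ENNReal.coe_le_coe]
        exact (add_le_add hs1.le hb.le).trans_eq (add_halves η)
    _ ≤ ε := hηε.le

/-- The exponent `r ≤ q` used for `f`. It is finite, and the weak-type sums converge for it: either
`p < r`, or `2 < r = p`. -/
theorem exists_exponent {p : ℝ} {q : ℝ≥0∞}
    (hq : (2 < p ∧ q = ENNReal.ofReal p) ∨ (p < 2 ∧ q = 2) ∨ (p = 2 ∧ 2 < q)) :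
    ∃ r : ℝ≥0, 1 ≤ r ∧ (r : ℝ≥0∞) ≤ q ∧ ((p < r ∧ 2 ≤ (r : ℝ)) ∨ (2 < p ∧ (r : ℝ) = p)) := by
  rcases hq with ⟨hp, rfl⟩ | ⟨hp, rfl⟩ | ⟨rfl, hq⟩
  · lift p to ℝ≥0 using by linarith
    refine ⟨p, ?_, by simp, Or.inr ⟨hp, rfl⟩⟩
    have : (1 : ℝ) ≤ p := by linarith
    exact_mod_cast this
  · exact ⟨2, one_le_two, le_rfl, Or.inl ⟨by simpa using hp, by simp⟩⟩
  · obtain ⟨r, hr1, hr2⟩ := ENNReal.lt_iff_exists_nnreal_btwn.mp hq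
    have hr : (2 : ℝ≥0) < r := by exact_mod_cast hr1
    have hr' : (2 : ℝ) < r := by exact_mod_cast hr
    exact ⟨r, one_le_two.trans hr.le, hr2.le, Or.inl ⟨hr', hr'.le⟩⟩

end Cwikel
end

theorem mainTheorem9 (d m₁ m₂ m₃ : ℕ) (p : ℝ) (hp : 0 < p) (q : ℝ≥0∞)
    (hq : (2 < p ∧ q = ENNReal.ofReal p) ∨ (p < 2 ∧ q = 2) ∨ (p = 2 ∧ 2 < q)) :
    ∃ C : ℝ≥0, ∀ (f : (Fin d → ℝ) → Matrix (Fin m₁) (Fin m₂) ℂ)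
      (W : (Fin d → ℤ) → Matrix (Fin m₂) (Fin m₃) ℂ),
      Cwikel.MatMemLp f q (Cwikel.torusMeasure d) →
      Cwikel.MatMemWeak W p Measure.count →
      ∃ A : Cwikel.SeqSpace d m₃ →L[ℂ] Cwikel.FunSpace d m₁,
        Cwikel.IsBorderedFourier f W A ∧
        Cwikel.MemSchattenWeak p A ∧
        Cwikel.schattenWeakNorm p A ≤
          C * Cwikel.matLpNorm f q (Cwikel.torusMeasure d) *
            Cwikel.matWeakNorm W p Measure.count ∧
        (Cwikel.MatMemWeakZero W p Measure.count → Cwikel.MemSchattenWeakZero p A) := by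
  obtain ⟨r, hr1, hrq, hr⟩ := Cwikel.exists_exponent hq
  obtain ⟨D, hD⟩ := Cwikel.exists_lintegral_entrySum_rpow_le d m₁ m₂ hr1 hrq
  obtain ⟨C, hC⟩ := Cwikel.exists_singularCount_le d m₁ m₂ m₃ p r hr
  set κ := Cwikel.entryCount m₂ m₃ with hκ
  refine ⟨C ^ (1 / p) * D * (κ ^ (1 / p) * κ), fun f W hf hW => ?_⟩
  have hF : Cwikel.matLpNorm f q (Cwikel.torusMeasure d) ≠ ∞ :=
    (Cwikel.iSup_iSup_lt_top fun i j => (hf i j).2).ne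
  have hw : Cwikel.matWeakNorm W p Measure.count ≠ ∞ :=
    (Cwikel.iSup_iSup_lt_top fun i j => (hW i j).2).ne
  have hfm : ∀ i j, AEStronglyMeasurable (fun x => f x i j) (Cwikel.torusMeasure d) :=
    fun i j => (hf i j).1
  have hfD := hD f hf
  lift Cwikel.matLpNorm f q (Cwikel.torusMeasure d) to ℝ≥0 using hF with F
  obtain ⟨w, hw'⟩ : ∃ w : ℝ≥0, (w : ℝ≥0∞) = Cwikel.matWeakNorm W p Measure.count :=
    ⟨_, ENNReal.coe_toNNReal hw⟩
  have hb := Cwikel.weakBound_entrySum hp hw'.ge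
  rw [← hw']
  rw [← hκ] at hb
  set b := κ ^ (1 / p) * κ * w with hbdef
  have hfin : ∀ ε : ℝ≥0, 0 < ε → {n | ε < Cwikel.entrySum (W n)}.Finite := fun ε hε => hb.finite hε
  have hbdd : BddAbove (Set.range fun n => Cwikel.entrySum (W n)) :=
    ⟨b, by rintro _ ⟨n, rfl⟩; exact hb.apply_le hp n⟩
  -- The counting estimate needs a positive bound for the norm of `f`. As `D F` may vanish, it is
  -- applied with positive `a ≥ D F`.
  have hfa : ∀ a : ℝ≥0, D * F ≤ a → ∫⁻ x, ((Cwikel.entrySum (f x) ^ (r : ℝ) : ℝ≥0) : ℝ≥0∞)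
      ∂(Cwikel.torusMeasure d) ≤ ((a ^ (r : ℝ) : ℝ≥0) : ℝ≥0∞) := fun a ha => by
    refine hfD.trans ?_
    rw [← ENNReal.coe_mul, ← ENNReal.coe_rpow_of_nonneg _ r.coe_nonneg, ENNReal.coe_le_coe]
    exact NNReal.rpow_le_rpow ha r.coe_nonneg
  have hE : ∀ τ : ℝ≥0, 0 < τ → Cwikel.overlapEnergy f W τ ∅ ≠ ∞ := fun τ hτ =>
    Cwikel.overlapEnergy_ne_top hp hr hb
      (ne_top_of_le_ne_top ENNReal.coe_ne_top (hfa _ le_rfl)) hτ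
  obtain ⟨A, hA⟩ := Cwikel.exists_clm_of_overlapEnergy_ne_top hfm hbdd hfin (hE 1 one_pos)
  have hcount : ∀ a : ℝ≥0, 0 < a → D * F ≤ a → ∀ s : ℝ≥0, 0 < s →
      (Cwikel.singularCount s A : ℝ≥0∞) ≤ ((C * (a * b / s) ^ p : ℝ≥0) : ℝ≥0∞) := by
    intro a ha hDa s hs
    have h1 := hC hfm hfin hA ∅ (a := a) (b := b) (s := s)
      (by rwa [Finset.coe_empty, Cwikel.offWeight_empty]) ha (hfa a hDa) hs
    simpa using h1
  have hnorm : Cwikel.schattenWeakNorm p A ≤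
      ((C ^ (1 / p) * D * (κ ^ (1 / p) * κ) : ℝ≥0) : ℝ≥0∞) * F * w := by
    refine ENNReal.le_of_forall_pos_le_add fun ε hε _ => ?_
    set L : ℝ≥0 := C ^ (1 / p) * b
    have h1 := Cwikel.schattenWeakNorm_le hp
      (hcount (D * F + ε / (L + 1)) (by positivity) (le_add_of_nonneg_right zero_le))
    refine h1.trans ?_
    rw [← ENNReal.coe_mul, ← ENNReal.coe_mul, ← ENNReal.coe_add, ENNReal.coe_le_coe]
    calc C ^ (1 / p) * ((D * F + ε / (L + 1)) * b)
        = C ^ (1 / p) * D * (κ ^ (1 / p) * κ) * F * w + L * (ε / (L + 1)) := by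
          simp only [L, hbdef]
          ring
      _ ≤ _ := by
          gcongr
          rw [mul_div_assoc', div_le_iff₀ (by positivity), mul_comm]
          gcongr
          exact le_add_of_nonneg_right zero_le
  have hmem : Cwikel.MemSchattenWeak p A :=
    ⟨Cwikel.isCompactOperator_of_overlapEnergy_ne_top hfm hfin hE hA,
      hnorm.trans_lt (by finiteness)⟩
  refine ⟨A, fun u => ⟨Cwikel.weightCLM W hbdd u, fun n => rfl, hA u⟩, hmem, hnorm,
    fun hW0 => ⟨hmem, ?_⟩⟩
  refine Cwikel.tendsto_singularCount_of_forall_le hp (C := C) (a := D * F + 1) fun b' hb' => ?_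
  obtain ⟨T, hT⟩ := Cwikel.exists_finset_weakBound_offWeight hfin hW0 hb'
  refine ⟨m₃ * T.card, fun s hs => ?_⟩
  have h1 := hC hfm hfin hA T hT (a := D * F + 1) (by positivity)
    (hfa _ (le_add_of_nonneg_right zero_le)) hs
  exact_mod_cast h1
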